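/- An effect algebra $(E;+,0,1)$ is a set with constants $0,1$ and a partial operation $+$ that is commutative and associative (in the sense that one side is defined iff the other is), such that every $a\in E$ has a unique $a'\in E$ with $a+a'=1$, and $a=0$ whenever $a+1$ is defined; it is ordered by $a\le b$ iff $a+c=b$ for some $c\in E$. Let $E$ be a complete lattice effect algebra, that is, an effect algebra which is a complete lattice in this order. An observable on $E$ is a map $x:\mathcal B(\mathbb R)\to E$ on the Borel sets with $x(\mathbb R)=1$, with $x(A\cup B)=x(A)+x(B)$ (the sum being defined) for disjoint $A,B$, and with $x(\bigcup_i A_i)=\bigvee_i x(A_i)$ for increasing sequences $(A_i)$. It is bounded if $x(C)=1$ for some compact $C$; its spectrum $\sigma(x)$ is the least closed set $K$ with $x(K)=1$. The Olson (spectral) order is defined by $x\preceq_s y$ iff $y((-\infty,t))\le x((-\infty,t))$ for all $t\in\mathbb R$. For $a\in E$ let $q_a$ be the observable with $q_a(\{1\})=a$ and $q_a(\{0\})=a'$. Theorem. (1) The set $\mathcal O_b(E)$ of bounded observables is a Dedekind complete lattice under $\preceq_s$: it is a lattice, every nonempty family that is bounded below has an infimum, and every nonempty family that is bounded above has a supremum.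 The infimum $x$ of a nonempty family $(x_\alpha)$ in $\mathcal O_b(E)$ that is bounded below in $\mathcal O_b(E)$ is given by $$x((-\infty,t))=\bigvee_\alpha x_\alpha((-\infty,t)),\qquad t\in\mathbb R,$$ and the supremum $x$ of a nonempty family $(x_\alpha)$ in $\mathcal O_b(E)$ that is bounded above in $\mathcal O_b(E)$ is given by $$x((-\infty,t))=\bigvee_{u<t}\bigwedge_\alpha x_\alpha((-\infty,u)),\qquad t\in\mathbb R.$$ (2) The set $\mathcal{EO}(E)$ of observables $x$ with $\sigma(x)\subseteq[0,1]$ is a complete lattice under $\preceq_s$; its bottom element is $q_0$ and its top element is $q_1$. -/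

import Mathlib

universe u

/-- An effect algebra: a set with constants `0`, `1` and a partial binary operation `+`.
`padd a b = some c` means that `a + b` is defined and equals `c`; `padd a b = none` means that
`a + b` is undefined.  The order is the induced one (`le_iff_exists_padd`); it is a field only so
that it can be shared with Mathlib's order classes, and it is determined by the operation. -/
class EffectAlgebra (E : Type u) extends PartialOrder E, Zero E, One E where
  /-- the partial addition -/
  padd : E → E → Option E
  padd_comm : ∀ a b : E, padd a b = padd b a
  /-- `(a + b) + c = a + (b + c)`, where one side is defined if and only if the other one is -/
  padd_assoc : ∀ a b c : E,
    ((padd a b).bind fun d => padd d c) = ((padd b c).bind fun d => padd a d)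
  existsUnique_padd_eq_one : ∀ a : E, ∃! b : E, padd a b = some 1
  eq_zero_of_padd_one : ∀ a c : E, padd a 1 = some c → a = 0
  /-- the order of the effect algebra: `a ≤ b` if and only if `a + c = b` for some `c` -/
  le_iff_exists_padd : ∀ a b : E, a ≤ b ↔ ∃ c : E, padd a c = some b

/-- A complete lattice effect algebra: an effect algebra which is a complete lattice in its
own order. -/
class CompleteLatticeEffectAlgebra (E : Type u) extends EffectAlgebra E, CompleteLattice E

namespace EffectAlgebra

variable {E : Type u} [EffectAlgebra E]

/-- The orthosupplement `a'`: the unique element with `a + a' = 1`. -/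
noncomputable def supp (a : E) : E := (existsUnique_padd_eq_one a).choose

theorem padd_supp (a : E) : padd a (supp a) = some 1 :=
  (existsUnique_padd_eq_one a).choose_spec.1

theorem eq_supp {a b : E} (h : padd a b = some 1) : b = supp a :=
  (existsUnique_padd_eq_one a).unique h (padd_supp a)

theorem supp_supp (a : E) : supp (supp a) = a :=
  (eq_supp (by rw [padd_comm]; exact padd_supp a)).symm

theorem supp_one : supp (1 : E) = 0 :=
  eq_zero_of_padd_one _ 1 (by rw [padd_comm]; exact padd_supp 1)

theorem padd_zero (a : E) : padd a 0 = some a := by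
  have h1 : padd (1 : E) 0 = some 1 := by
    have h := padd_supp (1 : E)
    rwa [supp_one] at h
  have h := padd_assoc (supp a) a (0 : E)
  rw [padd_comm (supp a) a, padd_supp] at h
  simp only [Option.bind_some, h1] at h
  obtain ⟨d, hd, hd'⟩ := Option.bind_eq_some_iff.1 h.symm
  rw [hd, eq_supp hd', supp_supp]

theorem zero_padd (a : E) : padd 0 a = some a := by
  rw [padd_comm]; exact padd_zero a

theorem zero_le' (a : E) : 0 ≤ a := (le_iff_exists_padd 0 a).2 ⟨a, zero_padd a⟩

end EffectAlgebra

/-- An observable on `E`: a map `x` from the Borel subsets of `ℝ` to `E` with `x(ℝ) = 1`, with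
`x(A ∪ B) = x(A) + x(B)` (the sum being defined) for disjoint Borel sets `A`, `B`, and with
`x(⋃ᵢ Aᵢ) = ⋁ᵢ x(Aᵢ)` for increasing sequences of Borel sets. -/
@[ext]
structure Observable (E : Type u) [EffectAlgebra E] where
  toFun : {A : Set ℝ // MeasurableSet A} → E
  map_univ : toFun ⟨Set.univ, MeasurableSet.univ⟩ = 1
  map_union : ∀ (A B : Set ℝ) (hA : MeasurableSet A) (hB : MeasurableSet B), Disjoint A B →
    EffectAlgebra.padd (toFun ⟨A, hA⟩) (toFun ⟨B, hB⟩) = some (toFun ⟨A ∪ B, hA.union hB⟩)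
  map_iUnion : ∀ (A : ℕ → Set ℝ) (hA : ∀ i, MeasurableSet (A i)), (∀ i, A i ⊆ A (i + 1)) →
    IsLUB (Set.range fun i => toFun ⟨A i, hA i⟩) (toFun ⟨⋃ i, A i, MeasurableSet.iUnion hA⟩)

namespace Observable

open EffectAlgebra

variable {E : Type u} [EffectAlgebra E]

/-- The spectral resolution `t ↦ x((-∞, t))` of an observable `x`. -/
def resolution (x : Observable E) (t : ℝ) : E := x.toFun ⟨Set.Iio t, measurableSet_Iio⟩

/-- The Olson (spectral) order: `x ≤ y` if and only if `y((-∞, t)) ≤ x((-∞, t))` for all real `t`.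
Antisymmetry is not part of this instance. -/
instance : Preorder (Observable E) where
  le x y := ∀ t : ℝ, y.resolution t ≤ x.resolution t
  le_refl _ _ := le_rfl
  le_trans _ _ _ hxy hyz t := (hyz t).trans (hxy t)

/-- `x` is bounded if `x(C) = 1` for some compact set `C`. -/
def IsBounded (x : Observable E) : Prop :=
  ∃ (C : Set ℝ) (hC : IsCompact C), x.toFun ⟨C, hC.measurableSet⟩ = 1

/-- The closed sets `K` with `x(K) = 1`. -/
def closedSupports (x : Observable E) : Set (Set ℝ) :=
  {K | ∃ hK : IsClosed K, x.toFun ⟨K, hK.measurableSet⟩ = 1}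

/-- The spectrum of `x`: the least closed set `K` with `x(K) = 1` (that the intersection is itself
such a set is `isLeast_spectrum`). -/
def spectrum (x : Observable E) : Set ℝ := ⋂₀ x.closedSupports

theorem map_compl (x : Observable E) (A : Set ℝ) (hA : MeasurableSet A) :
    x.toFun ⟨Aᶜ, hA.compl⟩ = supp (x.toFun ⟨A, hA⟩) := by
  apply eq_supp
  rw [x.map_union A Aᶜ hA hA.compl disjoint_compl_right]
  simp only [Set.union_compl_self, x.map_univ]

theorem mono (x : Observable E) {A B : Set ℝ} (hA : MeasurableSet A) (hB : MeasurableSet B)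
    (h : A ⊆ B) : x.toFun ⟨A, hA⟩ ≤ x.toFun ⟨B, hB⟩ := by
  rw [le_iff_exists_padd]
  refine ⟨x.toFun ⟨B \ A, hB.diff hA⟩, ?_⟩
  rw [x.map_union A (B \ A) hA (hB.diff hA) disjoint_sdiff_self_right]
  simp only [Set.union_sdiff_cancel h]

theorem null_union (x : Observable E) {A B : Set ℝ} (hA : MeasurableSet A) (hB : MeasurableSet B)
    (h0 : x.toFun ⟨A, hA⟩ = 0) (h1 : x.toFun ⟨B, hB⟩ = 0) :
    x.toFun ⟨A ∪ B, hA.union hB⟩ = 0 := by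
  have h2 : x.toFun ⟨B \ A, hB.diff hA⟩ = 0 :=
    le_antisymm ((x.mono _ hB Set.sdiff_subset).trans h1.le) (zero_le' _)
  have h := x.map_union A (B \ A) hA (hB.diff hA) disjoint_sdiff_self_right
  rw [h0, h2, padd_zero] at h
  simp only [Set.union_sdiff_self] at h
  exact (Option.some.inj h).symm

theorem null_iUnion (x : Observable E) (A : ℕ → Set ℝ) (hA : ∀ i, MeasurableSet (A i))
    (h0 : ∀ i, x.toFun ⟨A i, hA i⟩ = 0) :
    x.toFun ⟨⋃ i, A i, MeasurableSet.iUnion hA⟩ = 0 := by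
  have hm : ∀ n, MeasurableSet (Set.accumulate A n) := fun n =>
    MeasurableSet.biUnion (Set.to_countable _) fun i _ => hA i
  have hz : ∀ n, x.toFun ⟨Set.accumulate A n, hm n⟩ = 0 := by
    intro n
    induction n with
    | zero => simpa only [Set.accumulate_zero_nat] using h0 0
    | succ k ih =>
      simpa only [Set.accumulate_succ] using x.null_union (hm k) (hA (k + 1)) ih (h0 (k + 1))
  have h := x.map_iUnion (Set.accumulate A) hm
    fun i => Set.monotone_accumulate (Nat.le_succ i)
  simp only [Set.iUnion_accumulate] at h
  refine le_antisymm (h.2 ?_) (zero_le' _)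
  rintro _ ⟨n, rfl⟩
  exact (hz n).le

theorem isLeast_spectrum (x : Observable E) : IsLeast x.closedSupports x.spectrum := by
  refine ⟨⟨isClosed_sInter fun K hK => hK.1, ?_⟩, fun K hK => Set.sInter_subset_of_mem hK⟩
  have hU : ∀ U ∈ compl '' x.closedSupports, IsOpen U := by
    rintro _ ⟨K, hK, rfl⟩
    exact hK.1.isOpen_compl
  obtain ⟨T, hTc, hTs, hT⟩ := TopologicalSpace.isOpen_sUnion_countable _ hU
  have huniv : Set.univ ∈ x.closedSupports := ⟨isClosed_univ, x.map_univ⟩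
  have hs : (x.spectrum)ᶜ = ⋃₀ (insert ∅ T) := by
    rw [Set.sUnion_insert, Set.empty_union, hT, spectrum, Set.compl_sInter]
  obtain ⟨f, hf⟩ := (hTc.insert ∅).exists_eq_range (Set.insert_nonempty _ _)
  have hfm : ∀ i, ∃ h : MeasurableSet (f i), x.toFun ⟨f i, h⟩ = 0 := by
    intro i
    have hi : f i ∈ insert ∅ T := hf ▸ Set.mem_range_self i
    have hc : f i ∈ compl '' x.closedSupports := by
      rcases hi with hi | hi
      · exact ⟨Set.univ, huniv, by rw [hi, Set.compl_univ]⟩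
      · exact hTs hi
    obtain ⟨K, ⟨hK, hK1⟩, hKf⟩ := hc
    have := x.map_compl K hK.measurableSet
    rw [hK1, supp_one] at this
    exact ⟨hKf ▸ hK.measurableSet.compl, by simpa only [← hKf] using this⟩
  have hn := x.null_iUnion f (fun i => (hfm i).1) fun i => (hfm i).2
  have hcl : IsClosed x.spectrum := isClosed_sInter fun K hK => hK.1
  have hcompl := x.map_compl x.spectrum hcl.measurableSet
  have he : (x.spectrum)ᶜ = ⋃ i, f i := by rw [hs, hf, Set.sUnion_range]
  simp only [he] at hcompl
  rw [hn] at hcompl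
  rw [← supp_supp (x.toFun _), ← hcompl]
  exact (eq_supp (zero_padd (1 : E))).symm

open Classical in
/-- The question `q_a`: the observable with `q_a({1}) = a` and `q_a({0}) = a'`, that is,
`q_a(A)` is the sum of those of the elements `a'` (if `0 ∈ A`) and `a` (if `1 ∈ A`). -/
noncomputable def question (a : E) : Observable E where
  toFun A :=
    if (0 : ℝ) ∈ A.1 then (if (1 : ℝ) ∈ A.1 then 1 else supp a)
    else (if (1 : ℝ) ∈ A.1 then a else 0)
  map_univ := by simp
  map_union A B hA hB hd := by
    have h0 : (0 : ℝ) ∈ A → (0 : ℝ) ∉ B := fun h h' => Set.disjoint_left.1 hd h h'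
    have h1 : (1 : ℝ) ∈ A → (1 : ℝ) ∉ B := fun h h' => Set.disjoint_left.1 hd h h'
    have hs : padd (supp a) a = some 1 := by rw [padd_comm]; exact padd_supp a
    by_cases a0 : (0 : ℝ) ∈ A <;> by_cases a1 : (1 : ℝ) ∈ A <;>
      by_cases b0 : (0 : ℝ) ∈ B <;> by_cases b1 : (1 : ℝ) ∈ B <;>
      simp_all [padd_zero, zero_padd, padd_supp]
  map_iUnion A hA hm := by
    have hmono : Monotone A := monotone_nat_of_le_succ hm
    obtain ⟨n, hn⟩ : ∃ n, ∀ i, n ≤ i →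
        (((0 : ℝ) ∈ A i ↔ (0 : ℝ) ∈ ⋃ i, A i) ∧ ((1 : ℝ) ∈ A i ↔ (1 : ℝ) ∈ ⋃ i, A i)) := by
      have key : ∀ r : ℝ, ∃ n, ∀ i, n ≤ i → (r ∈ A i ↔ r ∈ ⋃ i, A i) := by
        intro r
        by_cases hr : r ∈ ⋃ i, A i
        · obtain ⟨n, hn⟩ := Set.mem_iUnion.1 hr
          exact ⟨n, fun i hi => iff_of_true (hmono hi hn) hr⟩
        · exact ⟨0, fun i _ => iff_of_false (fun h => hr (Set.mem_iUnion.2 ⟨i, h⟩)) hr⟩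
      obtain ⟨n, hn⟩ := key 0
      obtain ⟨m, hm⟩ := key 1
      exact ⟨max n m, fun i hi => ⟨hn i (le_of_max_le_left hi), hm i (le_of_max_le_right hi)⟩⟩
    have one_le : ∀ b : E, b ≤ 1 := fun b => (le_iff_exists_padd b 1).2 ⟨supp b, padd_supp b⟩
    constructor
    · rintro _ ⟨i, rfl⟩
      have h0 : (0 : ℝ) ∈ A i → (0 : ℝ) ∈ ⋃ i, A i := fun h => Set.mem_iUnion.2 ⟨i, h⟩
      have h1 : (1 : ℝ) ∈ A i → (1 : ℝ) ∈ ⋃ i, A i := fun h => Set.mem_iUnion.2 ⟨i, h⟩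
      by_cases a0 : (0 : ℝ) ∈ A i <;> by_cases a1 : (1 : ℝ) ∈ A i
      · simp only [a0, a1, h0 a0, h1 a1, if_true, le_refl]
      · simp only [a0, a1, h0 a0, if_true, if_false]
        split_ifs
        exacts [one_le _, le_rfl]
      · simp only [a0, a1, h1 a1, if_true, if_false]
        split_ifs
        exacts [one_le _, le_rfl]
      · simp only [a0, a1, if_false]
        exact zero_le' _
    · intro b hb
      have h := hb ⟨n, rfl⟩
      simpa only [(hn n le_rfl).1, (hn n le_rfl).2] using h

end Observable

/-- `O_b(E)`: the set of bounded observables on `E`. -/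
def boundedObservables (E : Type u) [EffectAlgebra E] : Set (Observable E) :=
  {x | x.IsBounded}

/-- `EO(E)`: the set of observables on `E` whose spectrum is contained in `[0, 1]`. -/
def unitObservables (E : Type u) [EffectAlgebra E] : Set (Observable E) :=
  {x | x.spectrum ⊆ Set.Icc 0 1}

/-- The preordered type `P` is a lattice: the order is antisymmetric and any two elements have an
infimum and a supremum. -/
def IsLatticeOrder (P : Type u) [Preorder P] : Prop :=
  (∀ a b : P, a ≤ b → b ≤ a → a = b) ∧
    ∀ a b : P, (∃ c, IsGLB {a, b} c) ∧ ∃ c, IsLUB {a, b} c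

/-- `P` is a Dedekind complete lattice: a lattice in which every nonempty set that is bounded below
has an infimum, and every nonempty set that is bounded above has a supremum. -/
def IsDedekindCompleteLattice (P : Type u) [Preorder P] : Prop :=
  IsLatticeOrder P ∧
    (∀ S : Set P, S.Nonempty → BddBelow S → ∃ z, IsGLB S z) ∧
    ∀ S : Set P, S.Nonempty → BddAbove S → ∃ z, IsLUB S z

/-- `P` is a complete lattice: a lattice in which every set has an infimum and a supremum. -/
def IsCompleteLatticeOrder (P : Type u) [Preorder P] : Prop :=
  IsLatticeOrder P ∧ ∀ S : Set P, (∃ z, IsGLB S z) ∧ ∃ z, IsLUB S z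

/-! The resolution of an observable is monotone and left-continuous, and it determines the
observable. The spectral order reverses the pointwise order of resolutions. So an infimum is the
pointwise supremum of resolutions, which stays left-continuous, and a supremum is the
left-continuous regularization of the pointwise infimum. What must be shown is that these functions
are resolutions: `exists_observable` says that every monotone left-continuous `F`, equal to 0 at
some point and to 1 beyond some other point, comes from an observable.

The values of `F` form a chain, hence are pairwise compatible, so their bicommutant is a complete
MV-algebra `M` whose suprema are those of `E` (`bicommutantMV`). Inside `M` a Loomis–Sikorski type
argument applies. Completeness makes `M` archimedean, so the homomorphisms `φ` into [0,1] separate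
elements (`le_of_forall_hom_le`); they form a compact space. Each `φ ∘ F` is a monotone real
function and yields a Stieltjes probability measure `ν φ`.

A homomorphism need not preserve countable suprema, but each increasing supremum is preserved by all
`φ` outside a meagre set (`eventually_residual_tendsto`). Hence the Borel sets `A` admitting an `a`
with `ν φ A = φ a` for comeagrely many `φ` contain the rays and are closed under complements and
countable disjoint unions, so they are all Borel sets. By Baire's theorem `a` is unique, and `A ↦ a`
is the observable. -/

/-! ### Arithmetic and order continuity in complete MV-algebras -/

/-- A complete MV-algebra, presented by its order and its truncated difference. -/
class CompleteMV (M : Type u) extends CompleteLattice M, Sub M where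
  sub_right_comm' : ∀ a b c : M, a - b - c = a - c - b
  sub_sub_eq_inf : ∀ a b : M, a - (a - b) = a ⊓ b
  sub_eq_bot_iff : ∀ a b : M, a - b = ⊥ ↔ a ≤ b

namespace CompleteMV

variable {M : Type u} [CompleteMV M]

theorem sub_le_comm {a b c : M} : a - b ≤ c ↔ a - c ≤ b := by
  rw [← sub_eq_bot_iff, sub_right_comm', sub_eq_bot_iff]

theorem sub_sub_top (a : M) : ⊤ - (⊤ - a) = a := by
  rw [sub_sub_eq_inf, top_inf_eq]

theorem compl_sub_compl (a b : M) : (⊤ - b) - (⊤ - a) = a - b := by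
  rw [sub_right_comm', sub_sub_top]

theorem compl_le_compl_iff {a b : M} : ⊤ - b ≤ ⊤ - a ↔ a ≤ b := by
  rw [← sub_eq_bot_iff, compl_sub_compl, sub_eq_bot_iff]

theorem sub_bot (a : M) : a - ⊥ = a := by
  apply le_antisymm
  · rw [sub_le_comm, (sub_eq_bot_iff a a).2 le_rfl]
  · rw [← sub_eq_bot_iff, sub_sub_eq_inf, inf_bot_eq]

/-- The truncated sum. -/
instance : Add M := ⟨fun a b => ⊤ - ((⊤ - a) - b)⟩

theorem add_def (a b : M) : a + b = ⊤ - ((⊤ - a) - b) := rfl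

instance : Zero M := ⟨⊥⟩

theorem zero_eq_bot : (0 : M) = ⊥ := rfl

/-- Residuation, obtained by passing to complements; it makes the general theory of ordered
subtraction available. -/
theorem sub_le_iff (a b c : M) : a - b ≤ c ↔ a ≤ c + b := by
  have h : a ≤ c + b ↔ (⊤ - c) - b ≤ ⊤ - a := by
    rw [add_def, ← compl_le_compl_iff, sub_sub_top]
  rw [h, sub_le_comm (a := ⊤ - c), compl_sub_compl, sub_le_comm]

theorem add_comm' (a b : M) : a + b = b + a := by
  rw [add_def, add_def, sub_right_comm']

theorem add_assoc' (a b c : M) : a + b + c = a + (b + c) := by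
  refine eq_of_forall_le_iff fun x => ?_
  rw [add_comm' a (b + c), ← sub_le_iff, ← sub_le_iff, ← sub_le_iff x a, ← sub_le_iff (x - a),
    sub_right_comm' x a c, sub_le_comm]

theorem add_zero' (a : M) : a + 0 = a := by
  rw [add_def, zero_eq_bot, sub_bot, sub_sub_top]

instance : AddCommMonoid M where
  add_assoc := add_assoc'
  zero_add a := by rw [add_comm', add_zero']
  add_zero := add_zero'
  add_comm := add_comm'
  nsmul := nsmulRec

instance : OrderedSub M := ⟨sub_le_iff⟩

theorem add_le_add_right' {b c : M} (h : b ≤ c) (a : M) : b + a ≤ c + a := by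
  rw [← sub_le_iff]
  exact ((sub_le_iff (b + a) a b).2 le_rfl).trans h

instance : IsOrderedAddMonoid M where
  add_le_add_left _ _ h a := add_le_add_right' h a

theorem add_sub_of_le {a b : M} (h : a ≤ b) : a + (b - a) = b := by
  rw [add_def, ← compl_sub_compl b a, sub_sub_eq_inf,
    inf_eq_right.2 (compl_le_compl_iff.2 h), sub_sub_top]

instance : CanonicallyOrderedAdd M where
  exists_add_of_le {a b} h := ⟨b - a, (add_sub_of_le h).symm⟩
  le_self_add a b := by
    calc a = a + 0 := (add_zero a).symm
      _ ≤ a + b := by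
        rw [add_comm a 0, add_comm a b]
        exact add_le_add_right' bot_le a
  le_add_self a b := by
    calc a = 0 + a := (zero_add a).symm
      _ ≤ b + a := add_le_add_right' bot_le a

theorem compl_add (a b : M) : ⊤ - (a + b) = (⊤ - a) - b := by
  rw [add_def, sub_sub_top]

theorem add_sub_cancel_of_le_compl {a b : M} (h : a ≤ ⊤ - b) : a + b - b = a := by
  rw [← compl_sub_compl, compl_add, sub_right_comm' ⊤ a b, sub_sub_eq_inf, inf_eq_right.2 h]

theorem le_compl_comm {a b : M} : a ≤ ⊤ - b ↔ b ≤ ⊤ - a := by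
  rw [← compl_le_compl_iff, sub_sub_top]

/-- Adding the meet `x` to `a ⊓ b` stays below both `a` and `b`, hence below `a ⊓ b`. This sum is
not truncated, so `x` cancels to zero. It is the source of linearity of the quotients by prime
ideals. -/
theorem sub_inf_sub (a b : M) : (a - b) ⊓ (b - a) = 0 := by
  refine le_antisymm ?_ bot_le
  set x := (a - b) ⊓ (b - a)
  have hm : a - (a - b) = b - (b - a) := by rw [sub_sub_eq_inf, sub_sub_eq_inf, inf_comm]
  have h1 : a ⊓ b + x ≤ a := by
    calc a ⊓ b + x ≤ (a - (a - b)) + (a - b) := by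
          rw [sub_sub_eq_inf]; exact add_le_add le_rfl inf_le_left
      _ = a := tsub_add_cancel_of_le tsub_le_self
  have h2 : a ⊓ b + x ≤ b := by
    calc a ⊓ b + x ≤ (b - (b - a)) + (b - a) := by
          rw [sub_sub_eq_inf, inf_comm b a]; exact add_le_add le_rfl inf_le_right
      _ = b := tsub_add_cancel_of_le tsub_le_self
  have h3 : x ≤ ⊤ - a ⊓ b := by
    have : x ≤ a - a ⊓ b := by
      rw [← sub_sub_eq_inf a b, sub_sub_eq_inf, inf_eq_right.2 tsub_le_self]
      exact inf_le_left
    exact this.trans (tsub_le_tsub_right le_top _)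
  have h4 := add_sub_cancel_of_le_compl h3
  rw [add_comm] at h4
  calc x = a ⊓ b + x - a ⊓ b := h4.symm
    _ ≤ a ⊓ b - a ⊓ b := tsub_le_tsub_right (le_inf h1 h2) _
    _ = 0 := tsub_self _

theorem inf_add_le (x y z : M) : x ⊓ (y + z) ≤ x ⊓ y + x ⊓ z := by
  set w := x ⊓ (y + z)
  have h1 : w - y ≤ x ⊓ z :=
    le_inf (tsub_le_self.trans inf_le_left) (tsub_le_iff_left.2 inf_le_right)
  have h2 : w - x ⊓ y = w - y := by
    have h : w ⊓ (x ⊓ y) = w ⊓ y := by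
      rw [← inf_assoc, inf_eq_left.2 (inf_le_left : w ≤ x)]
    have e : ∀ v : M, w - v = w - w ⊓ v := fun v => by
      rw [← sub_sub_eq_inf w v, sub_sub_eq_inf, inf_eq_right.2 tsub_le_self]
    rw [e, h, ← e]
  rw [← h2] at h1
  exact tsub_le_iff_left.1 h1

theorem eq_zero_of_sub_eq_self {a z : M} (hz : z ≤ a) (h : a ≤ a - z) : z = 0 := by
  rw [← inf_eq_right.2 hz, ← sub_sub_eq_inf]
  exact tsub_eq_zero_of_le h

/-- Archimedean property from completeness: otherwise no sum `n • d + d` is truncated, and the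
supremum of the multiples of `d` is unchanged by subtracting `d`, which forces `d = 0`. -/
theorem exists_sub_compl_nsmul_ne_zero {d : M} (hd : d ≠ 0) :
    ∃ n : ℕ, d - (⊤ - n • d) ≠ 0 := by
  by_contra! h
  have h' : ∀ n : ℕ, n • d ≤ ⊤ - d := fun n => by
    rw [le_compl_comm]; exact tsub_eq_zero_iff_le.1 (h n)
  apply hd
  refine eq_zero_of_sub_eq_self (a := ⨆ n : ℕ, n • d) ?_ (iSup_le fun n => ?_)
  · exact le_iSup_of_le 1 (one_nsmul d).ge
  · rw [← add_sub_cancel_of_le_compl (h' n), ← succ_nsmul]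
    exact tsub_le_tsub_right (le_iSup (fun n : ℕ => n • d) (n + 1)) d

theorem eq_zero_of_forall_le_sub {a : ℕ → M} {z : M}
    (h : ∀ n, z ≤ (⨆ i, a i) - a n) : z = 0 := by
  refine eq_zero_of_sub_eq_self (a := ⨆ i, a i) ((h 0).trans tsub_le_self) (iSup_le fun n => ?_)
  calc a n = (⨆ i, a i) - ((⨆ i, a i) - a n) := by
        rw [sub_sub_eq_inf, inf_eq_right.2 (le_iSup a n)]
    _ ≤ _ := tsub_le_tsub_left (h n) _

/-- The `k` copies of the gap are removed one at a time. Monotonicity allows one copy to carry its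
own index `m`, the maximum of `n` and `m` serving both; the induction hypothesis then disposes of
`n`. -/
theorem le_of_forall_le_nsmul_add {a : ℕ → M} (ha : Monotone a) (k : ℕ) :
    ∀ d w : M, (∀ n, d ≤ k • ((⨆ i, a i) - a n) + w) → d ≤ w := by
  induction k with
  | zero => intro d w h; simpa using h 0
  | succ k ih =>
    intro d w h
    have key : ∀ m, d - ((⨆ i, a i) - a m) ≤ w := fun m => by
      refine ih _ _ fun n => ?_
      rw [tsub_le_iff_right]
      calc d ≤ (k + 1) • ((⨆ i, a i) - a (max n m)) + w := h _
        _ = k • ((⨆ i, a i) - a (max n m)) + w + ((⨆ i, a i) - a (max n m)) := by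
          rw [succ_nsmul, add_right_comm]
        _ ≤ k • ((⨆ i, a i) - a n) + w + ((⨆ i, a i) - a m) :=
          add_le_add (add_le_add (nsmul_le_nsmul_right
            (tsub_le_tsub_left (ha (le_max_left _ _)) _) k) le_rfl)
            (tsub_le_tsub_left (ha (le_max_right _ _)) _)
    have h0 : d - w = 0 := eq_zero_of_forall_le_sub fun m => sub_le_comm.1 (key m)
    exact tsub_eq_zero_iff_le.1 h0

end CompleteMV

/-! ### Maximal ideals and their archimedean quotients -/

namespace CompleteMV

open Filter Topology

variable {M : Type u} [CompleteMV M]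

theorem add_sub_comm_max (x y : M) : x + (y - x) = y + (x - y) := by
  have e : ∀ v w : M, v ⊓ w + (v - w) = v := fun v w => by
    rw [← sub_sub_eq_inf]; exact tsub_add_cancel_of_le tsub_le_self
  calc x + (y - x) = x ⊓ y + (x - y) + (y - x) := by rw [e]
    _ = y ⊓ x + (y - x) + (x - y) := by rw [inf_comm, add_right_comm]
    _ = y + (x - y) := by rw [e]

theorem inf_nsmul_le (a b : M) (n : ℕ) : b ⊓ n • a ≤ n • (b ⊓ a) := by
  induction n with
  | zero => simp
  | succ n ih =>
    rw [succ_nsmul, succ_nsmul]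
    exact (inf_add_le _ _ _).trans (add_le_add ih le_rfl)

/-- Ideals: down-closed sets containing `0` and closed under truncated sums. -/
structure IsIdeal (J : Set M) : Prop where
  zero_mem : (0 : M) ∈ J
  mem_of_le : ∀ {a b : M}, a ≤ b → b ∈ J → a ∈ J
  add_mem : ∀ {a b : M}, a ∈ J → b ∈ J → a + b ∈ J

/-- Maximal ideals, described by the fact that the quotient is archimedean. -/
structure IsMaximalIdeal (J : Set M) : Prop extends IsIdeal J where
  top_notMem : (⊤ : M) ∉ J
  exists_compl_nsmul_mem : ∀ a, a ∉ J → ∃ n : ℕ, ⊤ - n • a ∈ J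

theorem isIdeal_disjoint (g : M) : IsIdeal {a : M | g ⊓ a = 0} where
  zero_mem := inf_bot_eq g
  mem_of_le h hb := le_antisymm ((inf_le_inf_left g h).trans hb.le) bot_le
  add_mem {a b} ha hb := by
    refine le_antisymm ((inf_add_le g a b).trans ?_) bot_le
    rw [show g ⊓ a = 0 from ha, show g ⊓ b = 0 from hb, add_zero]

/-- Zorn's lemma among proper ideals. If no `⊤ - n • a` were in `J`, the ideal generated by `J` and
`a` would still be proper. -/
theorem IsIdeal.exists_le_maximal {I : Set M} (hI : IsIdeal I) (htop : (⊤ : M) ∉ I) :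
    ∃ J, I ⊆ J ∧ IsMaximalIdeal J := by
  obtain ⟨J, hIJ, hJ⟩ := zorn_subset_nonempty {J : Set M | IsIdeal J ∧ (⊤ : M) ∉ J} (by
    rintro c hc hchain ⟨J₀, hJ₀⟩
    refine ⟨⋃₀ c, ⟨⟨⟨J₀, hJ₀, (hc hJ₀).1.zero_mem⟩, ?_, ?_⟩, ?_⟩, fun s hs =>
      Set.subset_sUnion_of_mem hs⟩
    · rintro a b hab ⟨K, hK, hb⟩
      exact ⟨K, hK, (hc hK).1.mem_of_le hab hb⟩
    · rintro a b ⟨K, hK, ha⟩ ⟨L, hL, hb⟩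
      rcases hchain.total hK hL with h | h
      · exact ⟨L, hL, (hc hL).1.add_mem (h ha) hb⟩
      · exact ⟨K, hK, (hc hK).1.add_mem ha (h hb)⟩
    · rintro ⟨K, hK, ht⟩
      exact (hc hK).2 ht) I ⟨hI, htop⟩
  refine ⟨J, hIJ, hJ.prop.1, hJ.prop.2, fun a ha => ?_⟩
  by_contra! hn
  have hJi := hJ.prop.1
  let L : Set M := {b | ∃ n : ℕ, ∃ j ∈ J, b ≤ j + n • a}
  have hL : IsIdeal L := by
    refine ⟨⟨0, 0, hJi.zero_mem, by simp⟩, ?_, ?_⟩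
    · rintro b c hbc ⟨n, j, hj, hc⟩
      exact ⟨n, j, hj, hbc.trans hc⟩
    · rintro b c ⟨n, j, hj, hb⟩ ⟨m, i, hi, hc⟩
      refine ⟨n + m, j + i, hJi.add_mem hj hi, (add_le_add hb hc).trans_eq ?_⟩
      rw [add_nsmul, add_add_add_comm]
  have hLt : (⊤ : M) ∉ L := by
    rintro ⟨n, j, hj, h⟩
    exact hn n (hJi.mem_of_le (tsub_le_iff_right.2 h) hj)
  have hJL : J ⊆ L := fun b hb => ⟨0, b, hb, by simp⟩
  exact ha (hJ.le_of_ge ⟨hL, hLt⟩ hJL ⟨1, 0, hJi.zero_mem, by simp⟩)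

theorem IsIdeal.nsmul_mem {J : Set M} (hJ : IsIdeal J) {a : M} (ha : a ∈ J) (n : ℕ) :
    n • a ∈ J := by
  induction n with
  | zero => simpa using hJ.zero_mem
  | succ n ih => rw [succ_nsmul]; exact hJ.add_mem ih ha

/-- The least `n` with `a ≤ n • e` modulo `J`. -/
noncomputable def count (J : Set M) (e a : M) : ℕ := sInf {n : ℕ | a - n • e ∈ J}

theorem count_le {J : Set M} {e a : M} {n : ℕ} (h : a - n • e ∈ J) : count J e a ≤ n :=
  Nat.sInf_le h

theorem notMem_of_lt_count {J : Set M} {e a : M} {n : ℕ} (h : n < count J e a) :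
    a - n • e ∉ J := fun h' => absurd (count_le h') (not_le.2 h)

namespace IsMaximalIdeal

variable {J : Set M}

/-- Maximal ideals are prime: meet `b` with `⊤ = (⊤ - n • a) + n • a`, where the first summand lies
in `J`. -/
theorem mem_or_mem (hJ : IsMaximalIdeal J) {a b : M} (h : a ⊓ b ∈ J) : a ∈ J ∨ b ∈ J := by
  by_cases ha : a ∈ J
  · exact Or.inl ha
  right
  obtain ⟨n, hn⟩ := hJ.exists_compl_nsmul_mem a ha
  have h1 : b ≤ (⊤ - n • a) + n • (b ⊓ a) := by
    calc b = b ⊓ ((⊤ - n • a) + n • a) := by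
          rw [tsub_add_cancel_of_le le_top, inf_top_eq]
      _ ≤ b ⊓ (⊤ - n • a) + b ⊓ n • a := inf_add_le _ _ _
      _ ≤ _ := add_le_add inf_le_right (inf_nsmul_le a b n)
  refine hJ.mem_of_le h1 (hJ.add_mem hn (hJ.toIsIdeal.nsmul_mem ?_ n))
  rwa [inf_comm]

theorem sub_mem_or_sub_mem (hJ : IsMaximalIdeal J) (a b : M) : a - b ∈ J ∨ b - a ∈ J := by
  apply hJ.mem_or_mem
  rw [sub_inf_sub]
  exact hJ.zero_mem

theorem count_spec (hJ : IsMaximalIdeal J) {e : M} (he : e ∉ J) (a : M) :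
    a - count J e a • e ∈ J := by
  have hne : {n : ℕ | a - n • e ∈ J}.Nonempty := by
    obtain ⟨n, hn⟩ := hJ.exists_compl_nsmul_mem e he
    exact ⟨n, hJ.mem_of_le (tsub_le_tsub_right le_top _) hn⟩
  exact Nat.sInf_mem hne

theorem count_eq_zero (hJ : IsMaximalIdeal J) {a : M} (e : M) (ha : a ∈ J) :
    count J e a = 0 :=
  Nat.le_zero.1 (count_le (hJ.mem_of_le tsub_le_self ha))

theorem count_mono (hJ : IsMaximalIdeal J) {e : M} (he : e ∉ J) {a b : M} (h : a ≤ b) :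
    count J e a ≤ count J e b :=
  count_le (hJ.mem_of_le (tsub_le_tsub_right h _) (hJ.count_spec he b))

theorem count_add_le (hJ : IsMaximalIdeal J) {e : M} (he : e ∉ J) (a b : M) :
    count J e (a + b) ≤ count J e a + count J e b := by
  apply count_le
  rw [add_nsmul]
  exact hJ.mem_of_le add_tsub_add_le_tsub_add_tsub
    (hJ.add_mem (hJ.count_spec he a) (hJ.count_spec he b))

theorem one_le_count_top (hJ : IsMaximalIdeal J) {e : M} (he : e ∉ J) :
    1 ≤ count J e ⊤ := by
  rw [Nat.one_le_iff_ne_zero]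
  intro h
  have := hJ.count_spec he ⊤
  rw [h, zero_nsmul, tsub_zero] at this
  exact hJ.top_notMem this

theorem add_count_le (hJ : IsMaximalIdeal J) {e : M} (he : e ∉ J) {a b : M} (hab : a ≤ ⊤ - b)
    {n : ℕ} (hn : n ≤ count J e a) (hna : n • e - a ∈ J) :
    n + count J e b ≤ count J e (a + b) := by
  obtain ⟨m, hm⟩ : ∃ m, count J e (a + b) = n + m :=
    Nat.exists_eq_add_of_le (hn.trans (hJ.count_mono he le_self_add))
  rw [hm]
  refine Nat.add_le_add_left (count_le ?_) n
  have h1 : b = a + b - a := by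
    rw [add_comm, add_sub_cancel_of_le_compl (le_compl_comm.1 hab)]
  have h2 := hJ.count_spec he (a + b)
  rw [hm, add_comm n m, add_nsmul, ← tsub_tsub] at h2
  rw [h1, tsub_right_comm]
  exact hJ.mem_of_le tsub_le_tsub_add_tsub (hJ.add_mem h2 hna)

/-- The quotient is linearly ordered, so `count J e a - 1` copies of `e` lie below `a` modulo `J`;
only this rounding is lost. -/
theorem count_add_count_le (hJ : IsMaximalIdeal J) {e : M} (he : e ∉ J) {a b : M}
    (hab : a ≤ ⊤ - b) : count J e a + count J e b ≤ count J e (a + b) + 1 := by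
  rcases Nat.eq_zero_or_pos (count J e a) with h0 | h0
  · have := hJ.add_count_le he hab (Nat.zero_le _) (by simpa using hJ.zero_mem)
    omega
  · have hlt : count J e a - 1 < count J e a := by omega
    have := hJ.add_count_le he hab hlt.le
      ((hJ.sub_mem_or_sub_mem _ _).resolve_left (notMem_of_lt_count hlt))
    omega

/-- When `e` is an atom modulo `J`, every `a` is congruent to a multiple of `e`, and nothing is lost
by rounding. -/
theorem count_add_eq (hJ : IsMaximalIdeal J) {e : M} (he : e ∉ J) (hatom : ∀ a ∉ J, e - a ∈ J)
    {a b : M} (hab : a ≤ ⊤ - b) : count J e (a + b) = count J e a + count J e b := by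
  refine le_antisymm (hJ.count_add_le he a b) (hJ.add_count_le he hab le_rfl ?_)
  obtain h0 | ⟨n, hn⟩ : count J e a = 0 ∨ ∃ n, count J e a = n + 1 := by
    cases count J e a <;> simp
  · rw [h0]; simpa using hJ.zero_mem
  · have h1 := notMem_of_lt_count (J := J) (e := e) (a := a) (n := n) (by omega)
    have h2 := hatom _ h1
    have h3 := (hJ.sub_mem_or_sub_mem _ _).resolve_left h1
    refine hJ.mem_of_le ?_ (hJ.add_mem h2 h3)
    rw [hn, tsub_le_iff_left, succ_nsmul]
    calc n • e + e ≤ n • e + ((e - (a - n • e)) + (a - n • e)) :=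
          add_le_add le_rfl le_tsub_add
      _ = (n • e + (a - n • e)) + (e - (a - n • e)) := by
          rw [add_assoc, add_comm (a - n • e)]
      _ = (a + (n • e - a)) + (e - (a - n • e)) := by rw [add_sub_comm_max]
      _ = a + ((e - (a - n • e)) + (n • e - a)) := by rw [add_assoc, add_comm (n • e - a)]

/-- An `e` with the largest count of `⊤` is an atom, since a proper splitting of `e` would give a
finer unit. -/
theorem exists_atom (hJ : IsMaximalIdeal J) {K : ℕ} (hK : ∀ e ∉ J, count J e ⊤ < K) :
    ∃ e ∉ J, ∀ a ∉ J, e - a ∈ J := by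
  have hbdd : BddAbove {n | ∃ e ∉ J, count J e ⊤ = n} :=
    ⟨K, by rintro _ ⟨e, he, rfl⟩; exact (hK e he).le⟩
  obtain ⟨e, he, hmax⟩ := Nat.sSup_mem (s := {n | ∃ e ∉ J, count J e ⊤ = n})
    ⟨_, ⊤, hJ.top_notMem, rfl⟩ hbdd
  refine ⟨e, he, fun a ha => ?_⟩
  by_contra hea
  have hδ : e ⊓ a ∉ J := fun h => (hJ.mem_or_mem h).elim he ha
  have hsub : e - e ⊓ a = e - a := by
    rw [← sub_sub_eq_inf e a, sub_sub_eq_inf, inf_eq_right.2 tsub_le_self]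
  -- The smaller of the two pieces of `e`. Since `x + x ≤ e`, the count for `e` is at most half of
  -- that for `x`, rounded up; maximality leaves only count one, and then `x ≤ ⊤ - x` puts `x` in
  -- `J`.
  set x := e ⊓ a ⊓ (e - e ⊓ a)
  have hx : x ∉ J := fun h => (hJ.mem_or_mem h).elim hδ (hsub ▸ hea)
  have hxx : x + x ≤ e := by
    calc x + x ≤ e ⊓ a + (e - e ⊓ a) := add_le_add inf_le_left inf_le_right
      _ = e := add_tsub_cancel_of_le inf_le_left
  have hle : count J x ⊤ ≤ count J e ⊤ := by
    rw [hmax]; exact le_csSup hbdd ⟨x, hx, rfl⟩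
  have h1 := hJ.count_spec hx ⊤
  have h2 : count J e ⊤ ≤ (count J x ⊤ + 1) / 2 := by
    refine count_le (hJ.mem_of_le (tsub_le_tsub_left ?_ _) h1)
    calc count J x ⊤ • x ≤ ((count J x ⊤ + 1) / 2 * 2) • x :=
          nsmul_le_nsmul_left bot_le (by omega)
      _ = ((count J x ⊤ + 1) / 2) • (x + x) := by rw [mul_nsmul', two_nsmul]
      _ ≤ _ := nsmul_le_nsmul_right hxx _
  have h3 : count J x ⊤ ≤ 1 := by omega
  have h4 : ⊤ - x ∈ J := by
    refine hJ.mem_of_le (tsub_le_tsub_left ?_ _) h1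
    calc count J x ⊤ • x ≤ 1 • x := nsmul_le_nsmul_left bot_le h3
      _ = x := one_nsmul x
  refine hx (hJ.mem_of_le ?_ h4)
  calc x ≤ e - e ⊓ a := inf_le_right
    _ ≤ ⊤ - x := tsub_le_tsub le_top inf_le_left

/-- If some unit has count of `⊤` at least `k + 1`, normalizing shrinks the defect of one to `1 / (k
+ 1)`. Otherwise counts are bounded and an atom counts exactly. -/
theorem exists_count_almost_additive (hJ : IsMaximalIdeal J) (k : ℕ) :
    ∃ e ∉ J, ∀ a b : M, a ≤ ⊤ - b →
      |(count J e (a + b) : ℝ) / count J e ⊤ - count J e a / count J e ⊤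
        - count J e b / count J e ⊤| ≤ 1 / (k + 1) := by
  by_cases h : ∃ e ∉ J, k + 1 ≤ count J e ⊤
  · obtain ⟨e, he, hk⟩ := h
    refine ⟨e, he, fun a b hab => ?_⟩
    have hk' : (k + 1 : ℝ) ≤ count J e ⊤ := by exact_mod_cast hk
    have hpos : (0 : ℝ) < k + 1 := by positivity
    rw [← sub_div, ← sub_div, abs_div, abs_of_pos (hpos.trans_le hk')]
    have h1 : (count J e (a + b) : ℝ) ≤ count J e a + count J e b := by
      exact_mod_cast hJ.count_add_le he a b
    have h2 : (count J e a + count J e b : ℝ) ≤ count J e (a + b) + 1 := by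
      exact_mod_cast hJ.count_add_count_le he hab
    refine div_le_div₀ zero_le_one ?_ hpos hk'
    rw [abs_le]
    constructor <;> linarith
  · push Not at h
    obtain ⟨e, he, hatom⟩ := hJ.exists_atom h
    refine ⟨e, he, fun a b hab => ?_⟩
    rw [hJ.count_add_eq he hatom hab]
    push_cast
    rw [add_div, add_sub_cancel_left, sub_self, abs_zero]
    positivity

end IsMaximalIdeal

/-! ### Homomorphisms into the real unit interval -/

/-- The lattice homomorphisms into the real unit interval which preserve truncated differences. -/
def homs (M : Type u) [CompleteMV M] : Set (M → ℝ) :=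
  {φ | φ ⊤ = 1 ∧ ∀ a b, φ (a - b) = max (φ a - φ b) 0}

/-- One of `a - b`, `b - a` lies in `J` and has value 0; additivity over `a = a ⊓ b + (a - b)` then
gives the value of the other. -/
theorem IsMaximalIdeal.mem_homs_of_additive {J : Set M} (hJ : IsMaximalIdeal J) {φ : M → ℝ}
    (h1 : φ ⊤ = 1) (hnn : ∀ a, 0 ≤ φ a) (hz : ∀ a ∈ J, φ a = 0)
    (hadd : ∀ a b, a ≤ ⊤ - b → φ (a + b) = φ a + φ b) : φ ∈ homs M := by
  have hsplit : ∀ a b, φ a = φ (a ⊓ b) + φ (a - b) := fun a b => by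
    have e : a ⊓ b + (a - b) = a := by
      rw [← sub_sub_eq_inf]; exact tsub_add_cancel_of_le tsub_le_self
    rw [← hadd, e]
    rw [← sub_sub_eq_inf]
    exact tsub_le_tsub_right le_top _
  refine ⟨h1, fun a b => ?_⟩
  have h2 := hsplit a b
  have h3 := hsplit b a
  rw [inf_comm] at h3
  rcases hJ.sub_mem_or_sub_mem a b with h | h
  · have h4 := hz _ h
    have h5 := hnn (b - a)
    rw [h4, max_eq_right]
    linarith
  · have h4 := hz _ h
    have h5 := hnn (a - b)
    rw [max_eq_left] <;> linarith

/-- Hölder's embedding of an archimedean chain: the normalized counts lie in a compact cube, and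
their limit along a nonprincipal ultrafilter is exactly additive. -/
theorem IsMaximalIdeal.exists_hom {J : Set M} (hJ : IsMaximalIdeal J) :
    ∃ φ ∈ homs M, ∀ a ∈ J, φ a = 0 := by
  choose e he hadd using hJ.exists_count_almost_additive
  let p : ℕ → M → ℝ := fun k a => count J (e k) a / count J (e k) ⊤
  have hpos : ∀ k, (0 : ℝ) < count J (e k) ⊤ := fun k => by
    exact_mod_cast hJ.one_le_count_top (he k)
  have hp : ∀ k, p k ∈ Set.pi Set.univ fun _ : M => Set.Icc (0 : ℝ) 1 := fun k a _ => by
    refine ⟨by positivity, div_le_one_of_le₀ ?_ (hpos k).le⟩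
    exact_mod_cast hJ.count_mono (he k) le_top
  obtain ⟨φ, -, hφ⟩ := (isCompact_univ_pi fun _ : M => isCompact_Icc).ultrafilter_le_nhds
    ((hyperfilter ℕ).map p) (by
      rw [le_principal_iff, Ultrafilter.mem_coe, Ultrafilter.mem_map]
      exact Filter.univ_mem' hp)
  have hlim : ∀ a, Tendsto (fun k => p k a) (hyperfilter ℕ) (𝓝 (φ a)) :=
    tendsto_pi_nhds.1 hφ
  have hφ1 : φ ⊤ = 1 := tendsto_nhds_unique (hlim ⊤)
    (tendsto_const_nhds.congr fun k => (div_self (hpos k).ne').symm)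
  have hz : ∀ a ∈ J, φ a = 0 := fun a ha => tendsto_nhds_unique (hlim a)
    (tendsto_const_nhds.congr fun k => by
      simp only [p]
      rw [hJ.count_eq_zero _ ha, Nat.cast_zero, zero_div])
  refine ⟨φ, hJ.mem_homs_of_additive hφ1
    (fun a => ge_of_tendsto' (hlim a) fun k => (hp k a trivial).1) hz fun a b hab => ?_, hz⟩
  have ht := ((hlim (a + b)).sub (hlim a)).sub (hlim b)
  have h0 : Tendsto (fun k => p k (a + b) - p k a - p k b) (hyperfilter ℕ) (𝓝 0) :=
    squeeze_zero_norm (fun k => hadd k a b hab)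
      (tendsto_one_div_add_atTop_nhds_zero_nat.mono_left Nat.hyperfilter_le_atTop)
  linarith [tendsto_nhds_unique ht h0]

namespace homs

variable {φ : M → ℝ}

theorem map_zero (hφ : φ ∈ homs M) : φ 0 = 0 := by
  have h := hφ.2 0 0
  rwa [tsub_self, sub_self, max_self] at h

theorem nonneg (hφ : φ ∈ homs M) (a : M) : 0 ≤ φ a := by
  have h := hφ.2 a 0
  rw [tsub_zero] at h
  rw [h]
  exact le_max_right _ _

theorem mono (hφ : φ ∈ homs M) {a b : M} (h : a ≤ b) : φ a ≤ φ b := by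
  have h := hφ.2 a b
  rw [tsub_eq_zero_of_le ‹_›, map_zero hφ] at h
  linarith [le_max_left (φ a - φ b) 0]

theorem le_one (hφ : φ ∈ homs M) (a : M) : φ a ≤ 1 := hφ.1 ▸ mono hφ le_top

theorem map_inf (hφ : φ ∈ homs M) (a b : M) : φ (a ⊓ b) = min (φ a) (φ b) := by
  rw [← sub_sub_eq_inf, hφ.2, hφ.2]
  have := nonneg hφ a
  rcases le_total (φ a) (φ b) with h | h
  · rw [min_eq_left h, max_eq_right (a := φ a - φ b) (by linarith), sub_zero, max_eq_left this]
  · rw [min_eq_right h, max_eq_left (a := φ a - φ b) (by linarith), sub_sub_cancel,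
      max_eq_left (nonneg hφ b)]

theorem map_compl (hφ : φ ∈ homs M) (a : M) : φ (⊤ - a) = 1 - φ a := by
  rw [hφ.2, hφ.1, max_eq_left (sub_nonneg.2 (le_one hφ a))]

theorem map_add (hφ : φ ∈ homs M) (a b : M) : φ (a + b) = min (φ a + φ b) 1 := by
  rw [add_def, map_compl hφ, hφ.2, map_compl hφ]
  rcases le_total (φ a + φ b) 1 with h | h
  · rw [min_eq_left h, max_eq_left] <;> linarith
  · rw [min_eq_right h, max_eq_right] <;> linarith

theorem map_sub_of_le (hφ : φ ∈ homs M) {a b : M} (h : a ≤ b) : φ (b - a) = φ b - φ a := by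
  rw [hφ.2, max_eq_left (sub_nonneg.2 (mono hφ h))]

theorem map_nsmul (hφ : φ ∈ homs M) (a : M) (n : ℕ) : φ (n • a) = min (n * φ a) 1 := by
  induction n with
  | zero => simp [map_zero hφ]
  | succ n ih =>
    rw [succ_nsmul, map_add hφ, ih]
    push_cast
    have := nonneg hφ a
    rcases le_total (n * φ a) 1 with h | h
    · rw [min_eq_left h, add_mul, one_mul]
    · rw [min_eq_right h, min_eq_right (by linarith), min_eq_right (by nlinarith)]

end homs

/-- For a suitable `n` the element `d - (⊤ - n • d)` is nonzero, so its polar is a proper ideal, and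
it contains `(⊤ - n • d) - d`. A homomorphism killing the polar cannot vanish at `d`, as then that
difference would have value 1. -/
theorem exists_hom_pos {d : M} (hd : d ≠ 0) : ∃ φ ∈ homs M, 0 < φ d := by
  obtain ⟨n, hn⟩ := exists_sub_compl_nsmul_ne_zero hd
  obtain ⟨J, hIJ, hJ⟩ := (isIdeal_disjoint (d - (⊤ - n • d))).exists_le_maximal
    (fun h => hn (by rwa [Set.mem_ofPred_eq, inf_top_eq] at h))
  obtain ⟨φ, hφ, hz⟩ := hJ.exists_hom
  refine ⟨φ, hφ, lt_of_le_of_ne (homs.nonneg hφ d) fun h0 => ?_⟩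
  have h1 : φ ((⊤ - n • d) - d) = 0 := hz _ (hIJ (sub_inf_sub _ _))
  rw [hφ.2, homs.map_compl hφ, homs.map_nsmul hφ, ← h0] at h1
  norm_num at h1

theorem le_of_forall_hom_le {a b : M} (h : ∀ φ ∈ homs M, φ a ≤ φ b) : a ≤ b := by
  by_contra hab
  obtain ⟨φ, hφ, hpos⟩ := exists_hom_pos (d := a - b) fun h0 => hab (tsub_eq_zero_iff_le.1 h0)
  rw [hφ.2, max_eq_right (sub_nonpos.2 (h φ hφ))] at hpos
  exact lt_irrefl _ hpos

end CompleteMV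

/-! ### Topology and Baire category on the space of homomorphisms -/

namespace CompleteMV

open Filter Topology MeasureTheory

variable {M : Type u} [CompleteMV M]

theorem homs.map_twice (φ : M → ℝ) (hφ : φ ∈ homs M) (a : M) :
    φ (a + a) = min (2 * φ a) 1 ∧
      φ (⊤ - ((⊤ - a) + (⊤ - a))) = max (2 * φ a - 1) 0 := by
  constructor
  · rw [map_add hφ, two_mul]
  · rw [map_compl hφ, map_add hφ, map_compl hφ]
    rcases le_total (2 * φ a) 1 with h | h
    · rw [min_eq_right (by linarith), max_eq_right (by linarith), sub_self]
    · rw [min_eq_left (by linarith), max_eq_left (by linarith)]; ring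

/-- Ramps of slope `2 ^ n` starting at `k / 2 ^ n` are MV-terms: the maps `min (2t) 1` and `max (2t
- 1) 0` zoom into the lower and upper half of the interval, according to the leading binary digit of
`k`. -/
theorem exists_scaled (n : ℕ) : ∀ (k : ℕ), k < 2 ^ n → ∀ a : M,
    ∃ d : M, ∀ φ ∈ homs M, φ d = max (min (2 ^ n * φ a - k) 1) 0 := by
  induction n with
  | zero =>
    intro k hk a
    refine ⟨a, fun φ hφ => ?_⟩
    have hk0 : k = 0 := by simpa using hk
    simp [hk0, homs.le_one hφ a, homs.nonneg hφ a]
  | succ n ih =>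
    intro k hk a
    rcases lt_or_ge k (2 ^ n) with h | h
    · obtain ⟨d, hd⟩ := ih k h (a + a)
      refine ⟨d, fun φ hφ => ?_⟩
      rw [hd φ hφ, (homs.map_twice φ hφ a).1]
      have h' : (k + 1 : ℝ) ≤ 2 ^ n := by exact_mod_cast h
      congr 1
      rcases le_total (2 * φ a) 1 with h1 | h1
      · rw [min_eq_left h1]; ring_nf
      · rw [min_eq_right h1, min_eq_right (by linarith), min_eq_right]
        rw [pow_succ]
        nlinarith
    · obtain ⟨m, rfl⟩ := Nat.exists_eq_add_of_le h
      obtain ⟨d, hd⟩ := ih m (by rw [pow_succ] at hk; omega) (⊤ - ((⊤ - a) + (⊤ - a)))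
      refine ⟨d, fun φ hφ => ?_⟩
      rw [hd φ hφ, (homs.map_twice φ hφ a).2]
      push_cast
      have hp : (0 : ℝ) < 2 ^ n := by positivity
      have hm : (0 : ℝ) ≤ m := m.cast_nonneg
      rcases le_total (2 * φ a - 1) 0 with h1 | h1
      · rw [max_eq_right h1, max_eq_right ((min_le_left _ _).trans (by linarith)), max_eq_right]
        refine (min_le_left _ _).trans ?_
        rw [pow_succ]
        nlinarith
      · rw [max_eq_left h1]; ring_nf

theorem exists_pos_of_lt {φ₀ : M → ℝ} (hφ₀ : φ₀ ∈ homs M) {a : M} {r : ℝ} (h : r < φ₀ a) :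
    ∃ d, 0 < φ₀ d ∧ ∀ φ ∈ homs M, 0 < φ d → r < φ a := by
  rcases lt_or_ge r 0 with hr | hr
  · exact ⟨⊤, by rw [hφ₀.1]; exact one_pos, fun φ hφ _ => hr.trans_le (homs.nonneg hφ a)⟩
  -- The dyadic mesh is finer than `φ₀ a - r`, so rounding `r` up to `k / 2 ^ n` stays below `φ₀ a`.
  obtain ⟨n, hn⟩ := exists_pow_lt_of_lt_one (sub_pos.2 h) (by norm_num : (1 / 2 : ℝ) < 1)
  have hp : (0 : ℝ) < 2 ^ n := by positivity
  have hn' : 1 < (φ₀ a - r) * 2 ^ n := by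
    rw [one_div, inv_pow] at hn
    exact (inv_lt_iff_one_lt_mul₀ hp).1 hn
  have hk1 := Nat.le_ceil (r * 2 ^ n)
  have hk2 := Nat.ceil_lt_add_one (by positivity : 0 ≤ r * 2 ^ n)
  set k := ⌈r * 2 ^ n⌉₊
  have hle : φ₀ a * 2 ^ n ≤ 1 * 2 ^ n := by
    gcongr; exact homs.le_one hφ₀ a
  have hk : k < 2 ^ n := by
    have : (k : ℝ) < 2 ^ n := by linarith
    exact_mod_cast this
  obtain ⟨d, hd⟩ := exists_scaled n k hk a
  refine ⟨d, ?_, fun φ hφ hpos => ?_⟩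
  · rw [hd φ₀ hφ₀, lt_max_iff, lt_min_iff]
    exact Or.inl ⟨by linarith, one_pos⟩
  · rw [hd φ hφ, lt_max_iff, lt_min_iff] at hpos
    have h1 := (hpos.resolve_right (lt_irrefl _)).1
    have h2 : r * 2 ^ n < φ a * 2 ^ n := by linarith
    exact lt_of_mul_lt_mul_right h2 hp.le

/-- The sets where an element is positive form a base of the topology: they are directed because
meets go to minima, and ramps detect strict inequalities. -/
theorem exists_pos_subset_nhds (φ₀ : homs M) {U : Set (homs M)} (hU : U ∈ 𝓝 φ₀) :
    ∃ d, 0 < φ₀.1 d ∧ ∀ φ : homs M, 0 < φ.1 d → φ ∈ U := by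
  let f : {d : M // 0 < φ₀.1 d} → Set (homs M) := fun d => {φ | 0 < φ.1 d.1}
  have hdir : Directed (· ≥ ·) f := fun d e =>
    ⟨⟨d.1 ⊓ e.1, by rw [homs.map_inf φ₀.2]; exact lt_min d.2 e.2⟩,
      fun φ (hφ : 0 < φ.1 _) => (lt_min_iff.1 (homs.map_inf φ.2 d.1 e.1 ▸ hφ)).1,
      fun φ (hφ : 0 < φ.1 _) => (lt_min_iff.1 (homs.map_inf φ.2 d.1 e.1 ▸ hφ)).2⟩
  have : Nonempty {d : M // 0 < φ₀.1 d} := ⟨⟨⊤, by rw [φ₀.2.1]; exact one_pos⟩⟩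
  have hle : ⨅ d, 𝓟 (f d) ≤ 𝓝 φ₀ := by
    rw [nhds_subtype, ← tendsto_iff_comap, tendsto_pi_nhds]
    intro a
    rw [tendsto_order]
    constructor
    · intro r hr
      obtain ⟨d, hd, h⟩ := exists_pos_of_lt φ₀.2 hr
      refine mem_iInf_of_mem (⟨d, hd⟩ : {d : M // 0 < φ₀.1 d}) (mem_principal.2 fun φ hφ => ?_)
      exact h φ.1 φ.2 hφ
    · intro r hr
      -- Upper bounds on `a` are lower bounds on its complement.
      have hr' : 1 - r < φ₀.1 (⊤ - a) := by rw [homs.map_compl φ₀.2]; linarith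
      obtain ⟨d, hd, h⟩ := exists_pos_of_lt φ₀.2 hr'
      refine mem_iInf_of_mem (⟨d, hd⟩ : {d : M // 0 < φ₀.1 d}) (mem_principal.2 fun φ hφ => ?_)
      have := h φ.1 φ.2 hφ
      rw [homs.map_compl φ.2] at this
      change φ.1 a < r
      linarith
  have hmem := hle hU
  rw [mem_iInf_of_directed
    (fun d e => (hdir d e).imp fun _ h => ⟨principal_mono.2 h.1, principal_mono.2 h.2⟩)] at hmem
  obtain ⟨d, hd⟩ := hmem
  exact ⟨d.1, d.2, fun φ hφ => hd hφ⟩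

theorem isClosed_homs : IsClosed (homs M) := by
  have : homs M = {φ | φ ⊤ = 1} ∩ ⋂ a, ⋂ b, {φ | φ (a - b) = max (φ a - φ b) 0} := by
    ext φ
    simp [homs]
  rw [this]
  refine (isClosed_eq (by fun_prop) (by fun_prop)).inter ?_
  exact isClosed_iInter fun a => isClosed_iInter fun b => isClosed_eq (by fun_prop) (by fun_prop)

instance : CompactSpace (homs M) := by
  rw [← isCompact_iff_compactSpace]
  exact (isCompact_univ_pi fun _ : M => isCompact_Icc (a := (0 : ℝ)) (b := 1)).of_isClosed_subset
    isClosed_homs fun φ hφ a _ => ⟨homs.nonneg hφ a, homs.le_one hφ a⟩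

theorem continuous_eval (a : M) : Continuous fun φ : homs M => φ.1 a :=
  (continuous_apply a).comp continuous_subtype_val

/-- A compact Hausdorff space is Baire, so a closed condition holding on a residual set holds
everywhere. -/
theorem le_of_eventually_residual {a b : M}
    (h : ∀ᶠ φ : homs M in residual (homs M), φ.1 a ≤ φ.1 b) : a ≤ b := by
  have hc : IsClosed {φ : homs M | φ.1 a ≤ φ.1 b} := isClosed_le (continuous_eval a) (continuous_eval b)
  have hd := (dense_of_mem_residual h).closure_eq
  rw [hc.closure_eq] at hd
  exact le_of_forall_hom_le fun φ hφ => hd.ge (Set.mem_univ (⟨φ, hφ⟩ : homs M))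

/-- The set where the gap falls below `1 / (k + 1)` at some index is open. Were it not dense, the
gaps would stay at least `1 / (k + 1)` where some `d ≠ 0` is positive, so `d` would lie below `k +
1` times every gap and vanish. -/
theorem eventually_residual_tendsto {a : ℕ → M} (ha : Monotone a) :
    ∀ᶠ φ : homs M in residual (homs M),
      Tendsto (fun n => φ.1 (a n)) atTop (𝓝 (φ.1 (⨆ n, a n))) := by
  have key : ∀ k : ℕ, ∀ᶠ φ : homs M in residual (homs M),
      ∃ n, φ.1 (⨆ i, a i) - φ.1 (a n) < 1 / (k + 1) := by
    intro k
    apply residual_of_dense_open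
    · rw [show {φ : homs M | ∃ n, φ.1 (⨆ i, a i) - φ.1 (a n) < 1 / (k + 1)} =
        ⋃ n, {φ : homs M | φ.1 (⨆ i, a i) - φ.1 (a n) < 1 / (k + 1)} by ext; simp]
      exact isOpen_iUnion fun n => isOpen_lt
        ((continuous_eval _).sub (continuous_eval _)) continuous_const
    · rw [dense_iff_inter_open]
      rintro U hU ⟨φ₀, hφ₀⟩
      obtain ⟨d, hd, hdU⟩ := exists_pos_subset_nhds φ₀ (hU.mem_nhds hφ₀)
      by_contra hcon
      have hge : ∀ φ ∈ U, ∀ n, 1 / (k + 1 : ℝ) ≤ φ.1 (⨆ i, a i) - φ.1 (a n) := by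
        intro φ hφ n
        by_contra! hlt
        exact hcon ⟨φ, hφ, n, hlt⟩
      have hd0 : d ≤ 0 := by
        refine le_of_forall_le_nsmul_add ha (k + 1) d 0 fun n => ?_
        rw [add_zero]
        refine le_of_forall_hom_le fun φ hφ => ?_
        rcases (homs.nonneg hφ d).eq_or_lt with h0 | h0
        · rw [← h0]; exact homs.nonneg hφ _
        · rw [homs.map_nsmul hφ, homs.map_sub_of_le hφ (le_iSup a n)]
          refine le_min ?_ (homs.le_one hφ d) |>.trans' le_rfl
          have h1 := hge ⟨φ, hφ⟩ (hdU ⟨φ, hφ⟩ h0) n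
          rw [div_le_iff₀ (by positivity)] at h1
          push_cast
          linarith [homs.le_one hφ d]
      have := homs.mono φ₀.2 hd0
      rw [homs.map_zero φ₀.2] at this
      linarith
  filter_upwards [eventually_countable_forall.2 key] with φ hφ
  have hm : Monotone fun n => φ.1 (a n) := fun i j h => homs.mono φ.2 (ha h)
  rw [Metric.tendsto_atTop]
  intro ε hε
  obtain ⟨k, hk⟩ := exists_nat_one_div_lt hε
  obtain ⟨n, hn⟩ := hφ k
  refine ⟨n, fun m hmn => ?_⟩
  rw [Real.dist_eq, abs_sub_comm, abs_of_nonneg (sub_nonneg.2 (homs.mono φ.2 (le_iSup a m)))]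
  linarith [hm hmn]

/-! ### Borel sets represented by elements of the MV-algebra -/

/-- `a` represents the Borel set `A` with respect to the family of measures `ν` if the value at
`a` of a generic homomorphism `φ` is the `ν φ`-measure of `A`. -/
def Represents (ν : homs M → Measure ℝ) (A : Set ℝ) (a : M) : Prop :=
  ∀ᶠ φ : homs M in residual (homs M), (ν φ).real A = φ.1 a

namespace Represents

variable {ν : homs M → Measure ℝ} [∀ φ, IsProbabilityMeasure (ν φ)] {A B : Set ℝ} {a b : M}

theorem mono (hA : Represents ν A a) (hB : Represents ν B b) (h : A ⊆ B) : a ≤ b := by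
  apply le_of_eventually_residual
  filter_upwards [hA, hB] with φ h1 h2
  rw [← h1, ← h2]
  exact measureReal_mono h

theorem unique (hA : Represents ν A a) (hB : Represents ν A b) : a = b :=
  le_antisymm (hA.mono hB subset_rfl) (hB.mono hA subset_rfl)

theorem univ : Represents ν Set.univ ⊤ :=
  Eventually.of_forall fun φ => by rw [probReal_univ, φ.2.1]

theorem compl (hA : Represents ν A a) (hm : MeasurableSet A) : Represents ν Aᶜ (⊤ - a) := by
  filter_upwards [hA] with φ h
  rw [probReal_compl_eq_one_sub hm, h, homs.map_compl φ.2]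

theorem union (hA : Represents ν A a) (hB : Represents ν B b) (hm : MeasurableSet B)
    (hd : Disjoint A B) : Represents ν (A ∪ B) (a + b) := by
  filter_upwards [hA, hB] with φ h1 h2
  have h3 := measureReal_union (μ := ν φ) hd hm
  rw [homs.map_add φ.2, min_eq_left, h3, h1, h2]
  rw [← h1, ← h2, ← h3]
  exact measureReal_le_one

theorem iUnion {A : ℕ → Set ℝ} {a : ℕ → M} (hA : ∀ n, Represents ν (A n) (a n))
    (hm : Monotone A) : Represents ν (⋃ n, A n) (⨆ n, a n) := by
  have ha : Monotone a := fun i j h => (hA i).mono (hA j) (hm h)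
  filter_upwards [eventually_residual_tendsto ha, eventually_countable_forall.2 hA] with φ h1 h2
  refine tendsto_nhds_unique ?_ h1
  have h3 := (ENNReal.tendsto_toReal (measure_ne_top (ν φ) (⋃ n, A n))).comp
    (tendsto_measure_iUnion_atTop (μ := ν φ) hm)
  exact h3.congr h2

theorem exists_of_Iio (h : ∀ t : ℝ, ∃ a, Represents ν (Set.Iio t) a) {A : Set ℝ}
    (hA : MeasurableSet A) : ∃ a, Represents ν A a := by
  refine MeasurableSpace.induction_on_inter (C := fun A _ => ∃ a, Represents ν A a)
    (BorelSpace.measurable_eq.trans (borel_eq_generateFrom_Iio ℝ)) isPiSystem_Iio ?_ ?_ ?_ ?_ A hA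
  · exact ⟨_, by simpa using (univ (ν := ν)).compl MeasurableSet.univ⟩
  · rintro _ ⟨t, rfl⟩
    exact h t
  · rintro A hA ⟨a, ha⟩
    exact ⟨_, ha.compl hA⟩
  · intro f hd hm hf
    have hacc : ∀ n, ∃ a, Represents ν (Set.accumulate f n) a := by
      intro n
      induction n with
      | zero => simpa only [Set.accumulate_zero_nat] using hf 0
      | succ n ih =>
        obtain ⟨a, ha⟩ := ih
        obtain ⟨b, hb⟩ := hf (n + 1)
        refine ⟨a + b, ?_⟩
        rw [Set.accumulate_succ]
        exact ha.union hb (hm _) (Set.disjoint_accumulate hd (Nat.lt_succ_self n))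
    choose a ha using hacc
    refine ⟨⨆ n, a n, ?_⟩
    rw [← Set.iUnion_accumulate]
    exact iUnion ha Set.monotone_accumulate

end Represents

/-- The measure of the open ray is the left limit of `φ ∘ F` at `t`. Along a sequence increasing to
`t`, left-continuity of `F` turns this into an increasing supremum, which a generic `φ` preserves.
-/
theorem represents_stieltjes {F : ℝ → M} (hleft : ∀ t, IsLUB (F '' Set.Iio t) (F t))
    (hφ : ∀ φ : homs M, Monotone fun t => φ.1 (F t))
    (hbot : ∀ φ, Tendsto (hφ φ).stieltjesFunction atBot (𝓝 0)) (t : ℝ) :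
    Represents (fun φ => (hφ φ).stieltjesFunction.measure) (Set.Iio t) (F t) := by
  obtain ⟨u, hu, hut, hlim⟩ := exists_seq_strictMono_tendsto t
  have hF : Monotone F := fun s t hst => le_of_forall_hom_le fun φ h => hφ ⟨φ, h⟩ hst
  have hsup : ⨆ n, F (u n) = F t := by
    refine le_antisymm (iSup_le fun n => hF (hut n).le) ((hleft t).2 ?_)
    rintro _ ⟨s, hs, rfl⟩
    obtain ⟨n, hn⟩ := (hlim.eventually (lt_mem_nhds hs)).exists
    exact (hF hn.le).trans (le_iSup (fun n => F (u n)) n)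
  have hu' : Tendsto u atTop (𝓝[<] t) :=
    tendsto_nhdsWithin_iff.2 ⟨hlim, Eventually.of_forall hut⟩
  filter_upwards [eventually_residual_tendsto (hF.comp hu.monotone)] with φ h
  simp only [Function.comp_apply, hsup] at h
  have h1 := (hφ φ).tendsto_leftLim t
  have h2 := tendsto_nhds_unique (h1.comp hu') h
  have h3 : Function.leftLim (hφ φ).stieltjesFunction t = φ.1 (F t) := by
    rw [show ((hφ φ).stieltjesFunction : ℝ → ℝ) = Function.rightLim fun t => φ.1 (F t) from
      funext (hφ φ).stieltjesFunction_eq, leftLim_rightLim h1, h2]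
  rw [measureReal_def, StieltjesFunction.measure_Iio _ (hbot φ), h3, sub_zero,
    ENNReal.toReal_ofReal (homs.nonneg φ.2 _)]

/-- A bounded left-continuous monotone family in a complete MV-algebra extends to an additive,
σ-continuous map on the Borel sets. -/
theorem exists_valuation {F : ℝ → M} (hF : Monotone F)
    (hleft : ∀ t, IsLUB (F '' Set.Iio t) (F t)) {l r : ℝ} (hl : F l = ⊥)
    (hr : ∀ t, r < t → F t = ⊤) :
    ∃ x : {A : Set ℝ // MeasurableSet A} → M,
      x ⟨Set.univ, MeasurableSet.univ⟩ = ⊤ ∧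
      (∀ (A B : Set ℝ) (hA : MeasurableSet A) (hB : MeasurableSet B), Disjoint A B →
        x ⟨A, hA⟩ ≤ x ⟨A ∪ B, hA.union hB⟩ ∧
          x ⟨A ∪ B, hA.union hB⟩ - x ⟨A, hA⟩ = x ⟨B, hB⟩) ∧
      (∀ (A : ℕ → Set ℝ) (hA : ∀ i, MeasurableSet (A i)), (∀ i, A i ⊆ A (i + 1)) →
        IsLUB (Set.range fun i => x ⟨A i, hA i⟩) (x ⟨⋃ i, A i, MeasurableSet.iUnion hA⟩)) ∧
      ∀ t : ℝ, x ⟨Set.Iio t, measurableSet_Iio⟩ = F t := by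
  have hφ : ∀ φ : homs M, Monotone fun t => φ.1 (F t) := fun φ s t h => homs.mono φ.2 (hF h)
  have hbot : ∀ φ, Tendsto (hφ φ).stieltjesFunction atBot (𝓝 0) := fun φ => by
    refine tendsto_const_nhds.congr' ?_
    filter_upwards [eventually_lt_atBot l] with t ht
    rw [(hφ φ).stieltjesFunction_eq]
    refine le_antisymm ((homs.nonneg φ.2 _).trans ((hφ φ).le_rightLim le_rfl)) ?_
    refine ((hφ φ).rightLim_le ht).trans ?_
    rw [hl]
    exact (homs.map_zero φ.2).le
  have htop : ∀ φ, Tendsto (hφ φ).stieltjesFunction atTop (𝓝 1) := fun φ => by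
    refine tendsto_const_nhds.congr' ?_
    filter_upwards [eventually_gt_atTop r] with t ht
    rw [(hφ φ).stieltjesFunction_eq]
    refine le_antisymm ?_ (((hφ φ).rightLim_le (lt_add_one t)).trans (homs.le_one φ.2 _))
    refine le_trans ?_ ((hφ φ).le_rightLim le_rfl)
    rw [hr t ht, φ.2.1]
  let ν : homs M → Measure ℝ := fun φ => (hφ φ).stieltjesFunction.measure
  have hν : ∀ φ, IsProbabilityMeasure (ν φ) := fun φ =>
    ⟨by rw [StieltjesFunction.measure_univ _ (hbot φ) (htop φ)]; simp⟩
  have hIio : ∀ t, Represents ν (Set.Iio t) (F t) := represents_stieltjes hleft hφ hbot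
  have hex : ∀ A : {A : Set ℝ // MeasurableSet A}, ∃ a, Represents ν A.1 a := fun A =>
    Represents.exists_of_Iio (fun t => ⟨F t, hIio t⟩) A.2
  choose x hx using hex
  refine ⟨x, (hx _).unique Represents.univ, fun A B hA hB hd => ?_, fun A hA hm => ?_,
    fun t => (hx _).unique (hIio t)⟩
  · refine ⟨(hx ⟨A, hA⟩).mono (hx ⟨A ∪ B, hA.union hB⟩) Set.subset_union_left, ?_⟩
    have h1 : x ⟨A ∪ B, hA.union hB⟩ = x ⟨B, hB⟩ + x ⟨A, hA⟩ := by
      rw [add_comm]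
      exact (hx ⟨A ∪ B, hA.union hB⟩).unique ((hx ⟨A, hA⟩).union (hx ⟨B, hB⟩) hB hd)
    rw [h1]
    -- Disjointness keeps the sum from being truncated, so the difference recovers the second
    -- summand.
    apply add_sub_cancel_of_le_compl
    exact (hx ⟨B, hB⟩).mono ((hx ⟨A, hA⟩).compl hA) hd.symm.subset_compl_right
  · have h := (hx ⟨⋃ i, A i, MeasurableSet.iUnion hA⟩).unique
      (Represents.iUnion (fun n => hx ⟨A n, hA n⟩) (monotone_nat_of_le_succ hm))
    rw [h]
    exact isLUB_iSup

end CompleteMV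

/-! ### Compatibility, commutants and the MV-algebra generated by a chain -/

namespace EffectAlgebra

section Basic

variable {E : Type u} [EffectAlgebra E]

theorem exists_of_padd_padd {a b c d e : E} (h : padd a b = some d) (h' : padd d c = some e) :
    ∃ f, padd b c = some f ∧ padd a f = some e := by
  have := padd_assoc a b c
  rw [h, Option.bind_some, h'] at this
  exact Option.bind_eq_some_iff.1 this.symm

theorem exists_of_padd_padd' {a b c f e : E} (h : padd b c = some f) (h' : padd a f = some e) :
    ∃ d, padd a b = some d ∧ padd d c = some e := by
  have := padd_assoc a b c
  rw [h, Option.bind_some, h'] at this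
  exact Option.bind_eq_some_iff.1 this

/-- Both `b` and `b'` are the orthosupplement of `a + c'`. -/
theorem padd_left_cancel {a b b' c : E} (h : padd a b = some c) (h' : padd a b' = some c) :
    b = b' := by
  have key : ∀ x, padd a x = some c → ∀ f, padd a (supp c) = some f → padd x f = some 1 := by
    intro x hx f hf
    rw [padd_comm] at hx
    obtain ⟨g, hg, hg'⟩ := exists_of_padd_padd hx (padd_supp c)
    rwa [← Option.some.inj (hf.symm.trans hg)] at hg'
  have h1 := h
  rw [padd_comm] at h1
  obtain ⟨f, hf, -⟩ := exists_of_padd_padd h1 (padd_supp c)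
  have e1 := key b h f hf
  have e2 := key b' h' f hf
  rw [padd_comm] at e1 e2
  rw [eq_supp e1, eq_supp e2]

theorem le_one' (a : E) : a ≤ 1 := (le_iff_exists_padd a 1).2 ⟨_, padd_supp a⟩

theorem le_of_padd_left {a b c : E} (h : padd a b = some c) : a ≤ c :=
  (le_iff_exists_padd a c).2 ⟨b, h⟩

theorem le_of_padd_right {a b c : E} (h : padd a b = some c) : b ≤ c :=
  le_of_padd_left (by rwa [padd_comm])

/-- If `a + b = c = a' + b'` and `a ≤ a'`, then `b' ≤ b`. -/
theorem le_of_padd_eq {a a' b b' c : E} (h : padd a b = some c) (h' : padd a' b' = some c)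
    (ha : a ≤ a') : b' ≤ b := by
  obtain ⟨z, hz⟩ := (le_iff_exists_padd a a').1 ha
  obtain ⟨f, hf, hf'⟩ := exists_of_padd_padd hz h'
  rw [padd_left_cancel h hf']
  exact le_of_padd_right hf

theorem exists_padd_of_le {a b b' c : E} (h : padd a b = some c) (hb : b' ≤ b) :
    ∃ d, padd a b' = some d ∧ d ≤ c := by
  obtain ⟨z, hz⟩ := (le_iff_exists_padd b' b).1 hb
  obtain ⟨d, hd, hd'⟩ := exists_of_padd_padd' hz h
  exact ⟨d, hd, le_of_padd_left hd'⟩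

theorem padd_le_padd_left {a b b' c c' : E} (h : padd a b = some c) (h' : padd a b' = some c')
    (hb : b ≤ b') : c ≤ c' := by
  obtain ⟨d, hd, hdc⟩ := exists_padd_of_le h' hb
  rwa [Option.some.inj (h.symm.trans hd)]

end Basic

section Lattice

variable {E : Type u} [CompleteLatticeEffectAlgebra E]

theorem zero_eq_bot : (0 : E) = ⊥ := le_antisymm (zero_le' _) bot_le

theorem one_eq_top : (1 : E) = ⊤ := le_antisymm le_top (le_one' _)

/-- The truncated difference: the element `c` with `a ⊓ b + c = a`. -/
noncomputable def tsub (a b : E) : E :=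
  ((le_iff_exists_padd (a ⊓ b) a).1 inf_le_left).choose

theorem padd_tsub (a b : E) : padd (a ⊓ b) (tsub a b) = some a :=
  ((le_iff_exists_padd (a ⊓ b) a).1 inf_le_left).choose_spec

theorem padd_tsub_of_le {a b : E} (h : b ≤ a) : padd b (tsub a b) = some a := by
  have := padd_tsub a b
  rwa [inf_eq_right.2 h] at this

theorem eq_tsub {a b c : E} (h : padd b c = some a) : c = tsub a b :=
  padd_left_cancel h (padd_tsub_of_le (le_of_padd_left h))

theorem tsub_le (a b : E) : tsub a b ≤ a := le_of_padd_right (padd_tsub a b)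

theorem tsub_tsub_eq_inf (a b : E) : tsub a (tsub a b) = a ⊓ b := by
  have h := padd_tsub a b
  rw [padd_comm] at h
  exact (eq_tsub h).symm

theorem tsub_eq_bot_iff (a b : E) : tsub a b = ⊥ ↔ a ≤ b := by
  rw [← zero_eq_bot]
  have h := padd_tsub a b
  constructor
  · intro h0
    rw [h0, padd_zero] at h
    exact inf_eq_left.1 (Option.some.inj h)
  · intro hab
    rw [inf_eq_left.2 hab] at h
    exact padd_left_cancel h (padd_zero a)

theorem tsub_inf_right (a b : E) : tsub a (a ⊓ b) = tsub a b :=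
  (eq_tsub (padd_tsub a b)).symm

/-- Compatibility of two elements. -/
def Compat (a b : E) : Prop := ∃ q ≤ b, padd a q = some (a ⊔ b)

theorem Compat.symm {a b : E} (h : Compat a b) : Compat b a := by
  obtain ⟨q, hq, haq⟩ := h
  obtain ⟨r, hr⟩ := (le_iff_exists_padd q b).1 hq
  obtain ⟨p, hp⟩ := (le_iff_exists_padd b (a ⊔ b)).1 le_sup_right
  obtain ⟨f, hf, hf'⟩ := exists_of_padd_padd hr hp
  rw [padd_comm] at haq
  rw [← padd_left_cancel haq hf'] at hf
  exact ⟨p, le_of_padd_right hf, by rwa [sup_comm]⟩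

theorem Compat.of_le {a b : E} (h : a ≤ b) : Compat a b :=
  ⟨tsub b a, tsub_le b a, by rw [sup_eq_right.2 h]; exact padd_tsub_of_le h⟩

/-- Elements with a common decomposition `a = r + p`, `b = r + q`, `p + r + q` defined, are
compatible. -/
theorem Compat.of_padd {a b q s : E} (hq : q ≤ b) (haq : padd a q = some s) (hb : b ≤ s) :
    Compat a b := by
  have hs : a ⊔ b ≤ s := sup_le (le_of_padd_left haq) hb
  obtain ⟨z, hz⟩ := (le_iff_exists_padd a (a ⊔ b)).1 le_sup_left
  obtain ⟨w, hw⟩ := (le_iff_exists_padd (a ⊔ b) s).1 hs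
  obtain ⟨f, hf, hf'⟩ := exists_of_padd_padd hz hw
  rw [padd_left_cancel hf' haq] at hf
  exact ⟨z, (le_of_padd_left hf).trans hq, hz⟩

/-- The witness of compatibility dominates `b - a ⊓ b`, so this sum exists below `a ⊔ b`; it also
dominates `b`, since `a ⊓ b ≤ a`. -/
theorem Compat.padd_tsub {a b : E} (h : Compat a b) : padd a (tsub b a) = some (a ⊔ b) := by
  obtain ⟨q, hq, haq⟩ := h
  obtain ⟨d, hd, hdle⟩ : ∃ d, padd a (tsub b a) = some d ∧ d ≤ a ⊔ b := by
    refine exists_padd_of_le haq ?_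
    obtain ⟨r, hr⟩ := (le_iff_exists_padd q b).1 hq
    obtain ⟨p, hp⟩ := (le_iff_exists_padd b (a ⊔ b)).1 le_sup_right
    obtain ⟨f, hf, hf'⟩ := exists_of_padd_padd hr hp
    rw [padd_comm] at haq
    rw [← padd_left_cancel haq hf'] at hf
    have hrb : r ≤ b ⊓ a := le_inf (le_of_padd_right hr) (le_of_padd_left hf)
    rw [padd_comm] at hr
    exact le_of_padd_eq hr (EffectAlgebra.padd_tsub b a) hrb
  rw [hd]
  refine congrArg some (le_antisymm hdle (sup_le (le_of_padd_left hd) ?_))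
  obtain ⟨p, hp⟩ := (le_iff_exists_padd (b ⊓ a) a).1 inf_le_right
  rw [padd_comm] at hp
  obtain ⟨f, hf, hf'⟩ := exists_of_padd_padd hp hd
  rw [← Option.some.inj ((EffectAlgebra.padd_tsub b a).symm.trans hf)] at hf'
  exact le_of_padd_right hf'

/-- The remainders `(a ⊔ b) - a` lie below the members of `S`, and their supremum already fills up
`(a ⊔ sSup S) - a`. -/
theorem Compat.sSup_right {a : E} {S : Set E} (h : ∀ b ∈ S, Compat a b) : Compat a (sSup S) := by
  rcases S.eq_empty_or_nonempty with rfl | ⟨b₀, hb₀⟩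
  · rw [sSup_empty]; exact (Compat.of_le bot_le).symm
  refine ⟨tsub (a ⊔ sSup S) a, ?_, padd_tsub_of_le le_sup_left⟩
  have hq : ∀ b ∈ S, tsub (a ⊔ b) a ≤ ⨆ b ∈ S, tsub (a ⊔ b) a := fun b hb =>
    le_iSup₂_of_le b hb le_rfl
  have hle : ⨆ b ∈ S, tsub (a ⊔ b) a ≤ tsub (a ⊔ sSup S) a := by
    refine iSup₂_le fun b hb => ?_
    obtain ⟨z, hz⟩ := (le_iff_exists_padd (a ⊔ b) (a ⊔ sSup S)).1
      (sup_le_sup_left (le_sSup hb) a)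
    obtain ⟨f, hf, hf'⟩ := exists_of_padd_padd (padd_tsub_of_le le_sup_left) hz
    rw [← eq_tsub hf']
    exact le_of_padd_left hf
  obtain ⟨d, hd, -⟩ := exists_padd_of_le (padd_tsub_of_le le_sup_left) hle
  have hsup : a ⊔ sSup S ≤ d := by
    refine sup_le (le_of_padd_left hd) (sSup_le fun b hb => ?_)
    exact le_sup_right.trans
      (padd_le_padd_left (padd_tsub_of_le (le_sup_left : a ≤ a ⊔ b)) hd (hq b hb))
  have h1 : tsub (a ⊔ sSup S) a ≤ ⨆ b ∈ S, tsub (a ⊔ b) a := by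
    obtain ⟨z, hz⟩ := (le_iff_exists_padd _ _).1 hsup
    obtain ⟨f, hf, hf'⟩ := exists_of_padd_padd (padd_tsub_of_le le_sup_left) hz
    rw [padd_left_cancel hd hf']
    exact le_of_padd_left hf
  refine h1.trans (iSup₂_le fun b hb => ?_)
  obtain ⟨q, hqb, haq⟩ := h b hb
  rw [← eq_tsub haq]
  exact hqb.trans (le_sSup hb)

/-- The elements compatible with `a` are closed under differences. -/
theorem Compat.of_padd_eq {a b c d : E} (hb : Compat a b) (hc : Compat a c)
    (hd : padd b d = some c) : Compat a d := by
  have hbc : b ≤ c := le_of_padd_left hd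
  have hb1 := hb.padd_tsub
  have hc1 := hc.padd_tsub
  have hb2 := EffectAlgebra.padd_tsub b a
  have hc2 := EffectAlgebra.padd_tsub c a
  -- The aim is `d = x + w`, with `x` below `a` and with `a + w` defined.
  obtain ⟨x, hx⟩ := (le_iff_exists_padd (b ⊓ a) (c ⊓ a)).1 (inf_le_inf_right a hbc)
  obtain ⟨w, hw⟩ := (le_iff_exists_padd (a ⊔ b) (a ⊔ c)).1 (sup_le_sup_left hbc a)
  obtain ⟨y, hy, hy'⟩ := exists_of_padd_padd hb1 hw
  rw [padd_left_cancel hy' hc1] at hy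
  -- `c = (b ⊓ a + x) + (tsub b a + w)`
  have hxa : x ≤ a := (le_of_padd_right hx).trans inf_le_right
  have hy1 := hy
  rw [padd_comm] at hy1
  obtain ⟨e, he, he'⟩ := exists_padd_of_le hc1 (le_of_padd_left hy1)
  have hd' : padd x w = some d := by
    obtain ⟨f, hf, hf'⟩ := exists_of_padd_padd hx hc2
    rw [padd_comm] at hf
    obtain ⟨g, hg, hg'⟩ := exists_of_padd_padd hy hf
    obtain ⟨k, hk, hk'⟩ := exists_of_padd_padd' hg' hf'
    rw [← Option.some.inj (hb2.symm.trans hk)] at hk'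
    rw [padd_comm, padd_left_cancel hd hk']
    exact hg
  refine Compat.of_padd (le_of_padd_right hd') he ?_
  obtain ⟨z, hz⟩ := (le_iff_exists_padd x a).1 hxa
  rw [padd_comm] at hz
  obtain ⟨f, hf, hf'⟩ := exists_of_padd_padd hz he
  rw [← Option.some.inj (hd'.symm.trans hf)] at hf'
  exact le_of_padd_right hf'

/-- Relative complementation in `[0, a]` reverses the order, so the remainder `z` of `a` over `a ⊓ c
⊔ (a - b)` is `(a - c) ⊓ b`. Compatibility then splits `a - c` as `((a - b) - c) + z`. -/
theorem tsub_right_comm {a b c : E} (h : Compat (a ⊓ c) (tsub a b)) :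
    tsub (tsub a b) c = tsub (tsub a c) b := by
  have hb := EffectAlgebra.padd_tsub a b
  have hc := EffectAlgebra.padd_tsub a c
  have hb' := hb
  have hc' := hc
  rw [padd_comm] at hb' hc'
  obtain ⟨z, hz⟩ := (le_iff_exists_padd (a ⊓ c ⊔ tsub a b) a).1 (sup_le inf_le_left (tsub_le a b))
  have hz1 : z ≤ tsub a c ⊓ (a ⊓ b) :=
    le_inf (le_of_padd_eq hc hz le_sup_left) (le_of_padd_eq hb' hz le_sup_right)
  have hz2 : tsub a c ⊓ (a ⊓ b) ≤ z := by
    have hu := padd_tsub_of_le (inf_le_left.trans (tsub_le a c) : tsub a c ⊓ (a ⊓ b) ≤ a)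
    have h1 : a ⊓ c ⊔ tsub a b ≤ tsub a (tsub a c ⊓ (a ⊓ b)) :=
      sup_le (le_of_padd_eq hu hc' inf_le_left) (le_of_padd_eq hu hb inf_le_right)
    rw [padd_comm] at hu
    exact le_of_padd_eq hz hu h1
  have hred : ∀ v w, v ≤ a → v ⊓ (a ⊓ w) = v ⊓ w := fun v w hv => by
    rw [← inf_assoc, inf_eq_left.2 hv]
  rw [hred _ _ (tsub_le a c)] at hz1 hz2
  obtain ⟨f, hf, hf'⟩ := exists_of_padd_padd h.padd_tsub hz
  rw [padd_left_cancel hf' hc, le_antisymm hz1 hz2, ← tsub_inf_right (tsub a b) (a ⊓ c),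
    hred _ _ (tsub_le a b), tsub_inf_right, padd_comm] at hf
  exact padd_left_cancel hf (EffectAlgebra.padd_tsub _ _)

/-- The commutant of a set: the elements compatible with all its elements. -/
def commutant (S : Set E) : Set E := {a | ∀ b ∈ S, Compat b a}

theorem commutant_antitone {S T : Set E} (h : S ⊆ T) : commutant T ⊆ commutant S :=
  fun _ ha b hb => ha b (h hb)

theorem subset_bicommutant (S : Set E) : S ⊆ commutant (commutant S) :=
  fun _ ha _ hb => (hb _ ha).symm

theorem sSup_mem_commutant {S T : Set E} (h : T ⊆ commutant S) : sSup T ∈ commutant S :=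
  fun b hb => Compat.sSup_right fun _ ha => h ha b hb

/-- By compatibility `a - b` equals `(b ⊔ a) - b`, and commutants are closed under joins and such
differences. -/
theorem tsub_mem_commutant {S : Set E} {a b : E} (ha : a ∈ commutant S) (hb : b ∈ commutant S)
    (hab : Compat b a) : tsub a b ∈ commutant S := fun s hs => by
  have hsup : b ⊔ a ∈ commutant S := by
    rw [← sSup_pair]
    exact sSup_mem_commutant (by rintro _ (rfl | rfl) <;> assumption)
  exact (hb s hs).of_padd_eq (hsup s hs) hab.padd_tsub

theorem one_mem_commutant (S : Set E) : 1 ∈ commutant S := fun b _ => Compat.of_le (le_one' b)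

theorem bicommutant_compat {S : Set E} (hS : S ⊆ commutant S) {a b : E}
    (ha : a ∈ commutant (commutant S)) (hb : b ∈ commutant (commutant S)) : Compat a b :=
  hb a (commutant_antitone hS ha)

/-- The supremum in the commutant is the one of `E`. -/
noncomputable abbrev commutantCompleteLattice (S : Set E) : CompleteLattice (commutant S) :=
  let _ : SupSet (commutant S) :=
    ⟨fun T => ⟨sSup (Subtype.val '' T), sSup_mem_commutant (by rintro _ ⟨x, -, rfl⟩; exact x.2)⟩⟩
  completeLatticeOfSup (commutant S) fun T =>
    ⟨fun x hx => le_sSup (α := E) ⟨x, hx, rfl⟩, fun x hx => sSup_le (α := E) (by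
      rintro _ ⟨y, hy, rfl⟩; exact hx hy)⟩

/-- The bicommutant of a set of pairwise compatible elements is a complete MV-algebra. -/
noncomputable abbrev bicommutantMV {S : Set E} (hS : S ⊆ commutant S) :
    CompleteMV (commutant (commutant S)) :=
  have hmem : ∀ a b : commutant (commutant S), tsub a.1 b.1 ∈ commutant (commutant S) :=
    fun a b => tsub_mem_commutant a.2 b.2 (bicommutant_compat hS b.2 a.2)
  let L := commutantCompleteLattice (commutant S)
  { L with
    sub := fun a b => ⟨tsub a.1 b.1, hmem a b⟩
    -- The meet `a ⊓ c` lies in the bicommutant because it is `a - (a - c)`.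
    sub_right_comm' := fun a b c => Subtype.ext (tsub_right_comm (by
      have h := hmem a ⟨_, hmem a c⟩
      simp only [tsub_tsub_eq_inf] at h
      exact bicommutant_compat hS h (hmem a b)))
    -- The lattice meet here is built from suprema, so it has to be identified with the meet of `E`.
    sub_sub_eq_inf := fun a b => by
      have h : tsub a.1 (tsub a.1 b.1) = a.1 ⊓ b.1 := tsub_tsub_eq_inf _ _
      refine le_antisymm (α := commutant (commutant S)) (L.le_inf _ _ _ ?_ ?_) ?_
      · exact h.le.trans inf_le_left
      · exact h.le.trans inf_le_right
      · exact (le_inf (L.inf_le_left a b) (L.inf_le_right a b) : (L.inf a b).1 ≤ a.1 ⊓ b.1).trans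
          h.ge
    sub_eq_bot_iff := fun a b => by
      have hbot : (L.bot : commutant (commutant S)).1 = ⊥ := by
        have h0 : (⊥ : E) ∈ commutant (commutant S) := by
          rw [← sSup_empty]; exact sSup_mem_commutant (Set.empty_subset _)
        exact le_bot_iff.1 (L.bot_le ⟨⊥, h0⟩)
      refine Subtype.ext_iff.trans ?_
      change tsub a.1 b.1 = (L.bot : commutant (commutant S)).1 ↔ _
      rw [hbot]
      exact tsub_eq_bot_iff _ _ }

/-- Comparable elements are compatible, so `F` takes values in a complete MV-algebra, where it
extends to Borel sets. -/
theorem exists_observable {F : ℝ → E} (hF : Monotone F)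
    (hleft : ∀ t, IsLUB (F '' Set.Iio t) (F t)) {l r : ℝ} (hl : F l = ⊥)
    (hr : ∀ t, r < t → F t = ⊤) : ∃ x : Observable E, ∀ t, x.resolution t = F t := by
  have hS : Set.range F ⊆ commutant (Set.range F) := by
    rintro _ ⟨s, rfl⟩ _ ⟨t, rfl⟩
    rcases le_total s t with h | h
    · exact (Compat.of_le (hF h)).symm
    · exact Compat.of_le (hF h)
  let _ := bicommutantMV hS
  let G : ℝ → commutant (commutant (Set.range F)) :=
    fun t => ⟨F t, subset_bicommutant _ ⟨t, rfl⟩⟩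
  have htop : (⊤ : commutant (commutant (Set.range F))).1 = 1 :=
    le_antisymm (le_one' _) (le_top (a := (⟨1, one_mem_commutant _⟩ :
      commutant (commutant (Set.range F)))))
  -- Suprema in the bicommutant agree with those of `E`, so σ-continuity transfers back.
  have hlub : ∀ (T : Set (commutant (commutant (Set.range F)))) z, IsLUB T z →
      IsLUB (Subtype.val '' T) z.1 := by
    intro T z hz
    rw [show z = sSup T from hz.unique (isLUB_sSup T)]
    exact isLUB_sSup _
  obtain ⟨x, h1, h2, h3, h4⟩ := CompleteMV.exists_valuation (F := G) (l := l) (r := r)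
    (fun s t h => hF h)
    (fun t => ⟨by rintro _ ⟨s, hs, rfl⟩; exact hF (le_of_lt hs), fun z hz => (hleft t).2 (by
      rintro _ ⟨s, hs, rfl⟩; exact hz ⟨s, hs, rfl⟩)⟩)
    (by
      refine le_bot_iff.1 ?_
      change F l ≤ _
      rw [hl]; exact bot_le)
    (fun t ht => Subtype.ext (by rw [htop, one_eq_top]; exact hr t ht))
  refine ⟨⟨fun A => (x A).1, by rw [h1, htop], fun A B hA hB hd => ?_, fun A hA hm => ?_⟩,
    fun t => congrArg Subtype.val (h4 t)⟩
  · obtain ⟨hle, hsub⟩ := h2 A B hA hB hd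
    rw [← hsub]
    exact padd_tsub_of_le hle
  · have := hlub _ _ (h3 A hA hm)
    rwa [← Set.range_comp] at this

end Lattice

end EffectAlgebra

/-! ### Spectral resolutions of bounded and unit observables -/

namespace Observable

open EffectAlgebra

section Resolution

variable {E : Type u} [EffectAlgebra E] (x : Observable E)

theorem map_compl_eq_zero_iff {A : Set ℝ} (hA : MeasurableSet A) :
    x.toFun ⟨Aᶜ, hA.compl⟩ = 0 ↔ x.toFun ⟨A, hA⟩ = 1 := by
  rw [x.map_compl A hA]
  constructor
  · intro h
    rw [← supp_supp (x.toFun _), h]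
    exact (eq_supp (zero_padd (1 : E))).symm
  · intro h
    rw [h, supp_one]

theorem eq_one_of_subset {A B : Set ℝ} (hA : MeasurableSet A) (hB : MeasurableSet B) (h : A ⊆ B)
    (h1 : x.toFun ⟨A, hA⟩ = 1) : x.toFun ⟨B, hB⟩ = 1 :=
  le_antisymm (le_one' _) (h1 ▸ x.mono hA hB h)

theorem eq_zero_of_subset {A B : Set ℝ} (hA : MeasurableSet A) (hB : MeasurableSet B) (h : A ⊆ B)
    (h0 : x.toFun ⟨B, hB⟩ = 0) : x.toFun ⟨A, hA⟩ = 0 :=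
  le_antisymm (h0 ▸ x.mono hA hB h) (zero_le' _)

theorem resolution_mono : Monotone x.resolution := fun _ _ h =>
  x.mono measurableSet_Iio measurableSet_Iio (Set.Iio_subset_Iio h)

theorem isLUB_resolution (t : ℝ) : IsLUB (x.resolution '' Set.Iio t) (x.resolution t) := by
  obtain ⟨u, hu, hut, hlim⟩ := exists_seq_strictMono_tendsto t
  have hU : ⋃ n, Set.Iio (u n) = Set.Iio t := by
    ext s
    simp only [Set.mem_iUnion, Set.mem_Iio]
    exact ⟨fun ⟨n, hn⟩ => hn.trans (hut n), fun hs => (hlim.eventually (lt_mem_nhds hs)).exists⟩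
  have h := x.map_iUnion (fun n => Set.Iio (u n)) (fun _ => measurableSet_Iio)
    fun n => Set.Iio_subset_Iio (hu n.lt_succ_self).le
  simp only [hU] at h
  refine ⟨?_, fun z hz => h.2 ?_⟩
  · rintro _ ⟨s, hs, rfl⟩
    exact x.resolution_mono (le_of_lt hs)
  · rintro _ ⟨n, rfl⟩
    exact hz ⟨u n, hut n, rfl⟩

/-- An observable is determined by its spectral resolution. -/
theorem ext_resolution {x y : Observable E} (h : ∀ t, x.resolution t = y.resolution t) :
    x = y := by
  refine Observable.ext (funext fun A => ?_)
  refine MeasurableSpace.induction_on_inter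
    (C := fun A hA => x.toFun ⟨A, hA⟩ = y.toFun ⟨A, hA⟩)
    (BorelSpace.measurable_eq.trans (borel_eq_generateFrom_Iio ℝ)) isPiSystem_Iio
    ?_ ?_ ?_ ?_ A.1 A.2
  · have hx := x.map_compl _ MeasurableSet.univ
    have hy := y.map_compl _ MeasurableSet.univ
    rw [map_univ, ← y.map_univ, ← hy] at hx
    simpa only [Set.compl_univ] using hx
  · rintro _ ⟨t, rfl⟩
    exact h t
  · intro A hA hxy
    rw [x.map_compl A hA, y.map_compl A hA, hxy]
  · intro f hd hm hf
    have hacc : ∀ n, ∃ hn : MeasurableSet (Set.accumulate f n),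
        x.toFun ⟨_, hn⟩ = y.toFun ⟨_, hn⟩ := by
      intro n
      induction n with
      | zero => simpa only [Set.accumulate_zero_nat] using ⟨hm 0, hf 0⟩
      | succ n ih =>
        obtain ⟨hn, he⟩ := ih
        rw [Set.accumulate_succ]
        refine ⟨hn.union (hm _), Option.some.inj ?_⟩
        have hdis := Set.disjoint_accumulate hd n.lt_succ_self
        rw [← x.map_union _ _ hn (hm _) hdis, ← y.map_union _ _ hn (hm _) hdis, he, hf]
    choose hn he using hacc
    have hmono : ∀ n, Set.accumulate f n ⊆ Set.accumulate f (n + 1) := fun n =>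
      Set.monotone_accumulate n.le_succ
    have hx := x.map_iUnion _ hn hmono
    have hy := y.map_iUnion _ hn hmono
    simp only [he] at hx
    have := hx.unique hy
    simpa only [Set.iUnion_accumulate] using this

/-- Rays are open, so mass at `b` is seen only by `t > b`; the complement of the interval is a ray
and countably many null half-lines. -/
theorem map_Icc_eq_one_iff {a b : ℝ} :
    x.toFun ⟨Set.Icc a b, measurableSet_Icc⟩ = 1 ↔
      x.resolution a = 0 ∧ ∀ t, b < t → x.resolution t = 1 := by
  constructor
  · refine fun h => ⟨?_, fun t ht => ?_⟩
    · refine x.eq_zero_of_subset measurableSet_Iio measurableSet_Icc.compl (fun s hs hs' => ?_)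
        ((x.map_compl_eq_zero_iff measurableSet_Icc).2 h)
      exact not_le.2 hs hs'.1
    · exact x.eq_one_of_subset measurableSet_Icc measurableSet_Iio (fun s hs => hs.2.trans_lt ht) h
  · rintro ⟨h0, h1⟩
    rw [← x.map_compl_eq_zero_iff measurableSet_Icc]
    have hm : ∀ n : ℕ, MeasurableSet (Set.Iio (b + 1 / (n + 1 : ℝ)))ᶜ := fun n =>
      measurableSet_Iio.compl
    have hnull := x.null_iUnion (fun n : ℕ => (Set.Iio (b + 1 / (n + 1 : ℝ)))ᶜ) hm fun n =>
      (x.map_compl_eq_zero_iff measurableSet_Iio).2 (h1 _ (lt_add_of_pos_right b (by positivity)))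
    refine x.eq_zero_of_subset _ _ (fun s hs => ?_)
      (x.null_union measurableSet_Iio (MeasurableSet.iUnion hm) h0 hnull)
    rcases lt_or_ge s a with hsa | hsa
    · exact Or.inl hsa
    · have hsb : b < s := not_le.1 fun h => hs ⟨hsa, h⟩
      obtain ⟨n, hn⟩ := exists_nat_one_div_lt (sub_pos.2 hsb)
      refine Or.inr (Set.mem_iUnion.2 ⟨n, ?_⟩)
      simp only [Set.mem_compl_iff, Set.mem_Iio, not_lt]
      linarith

theorem mem_boundedObservables_iff :
    x ∈ boundedObservables E ↔
      ∃ a b, x.resolution a = 0 ∧ ∀ t, b < t → x.resolution t = 1 := by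
  simp only [← map_Icc_eq_one_iff]
  constructor
  · rintro ⟨C, hC, h⟩
    obtain ⟨a, b, hab⟩ := bddBelow_bddAbove_iff_subset_Icc.1 ⟨hC.bddBelow, hC.bddAbove⟩
    exact ⟨a, b, x.eq_one_of_subset _ _ hab h⟩
  · rintro ⟨a, b, h⟩
    exact ⟨_, isCompact_Icc, h⟩

theorem mem_unitObservables_iff :
    x ∈ unitObservables E ↔ x.resolution 0 = 0 ∧ ∀ t, 1 < t → x.resolution t = 1 := by
  rw [← map_Icc_eq_one_iff]
  constructor
  · intro h
    obtain ⟨hc, h1⟩ := x.isLeast_spectrum.1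
    exact x.eq_one_of_subset hc.measurableSet _ h h1
  · intro h
    exact x.isLeast_spectrum.2 ⟨isClosed_Icc, h⟩

theorem resolution_question_zero (t : ℝ) :
    (question (0 : E)).resolution t = if 0 < t then 1 else 0 := by
  have h : supp (0 : E) = 1 := (eq_supp (zero_padd (1 : E))).symm
  by_cases h0 : 0 < t <;> by_cases h1 : 1 < t <;> simp [resolution, question, h0, h]

theorem resolution_question_one (t : ℝ) :
    (question (1 : E)).resolution t = if 1 < t then 1 else 0 := by
  by_cases h0 : 0 < t <;> by_cases h1 : 1 < t <;>
    simp [resolution, question, h1, supp_one]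

theorem question_zero_mem : question (0 : E) ∈ unitObservables E := by
  rw [mem_unitObservables_iff]
  refine ⟨by simp [resolution_question_zero], fun t ht => ?_⟩
  rw [resolution_question_zero, if_pos (one_pos.trans ht)]

theorem question_one_mem : question (1 : E) ∈ unitObservables E := by
  rw [mem_unitObservables_iff]
  refine ⟨?_, fun t ht => by rw [resolution_question_one, if_pos ht]⟩
  rw [resolution_question_one, if_neg (by norm_num)]

theorem isBot_question_zero :
    IsBot (⟨question 0, question_zero_mem⟩ : unitObservables E) := by
  intro x t
  change x.1.resolution t ≤ (question 0).resolution t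
  rw [resolution_question_zero]
  split_ifs with h
  · exact le_one' _
  · exact ((mem_unitObservables_iff x.1).1 x.2).1 ▸ x.1.resolution_mono (not_lt.1 h)

theorem isTop_question_one :
    IsTop (⟨question 1, question_one_mem⟩ : unitObservables E) := by
  intro x t
  change (question 1).resolution t ≤ x.1.resolution t
  rw [resolution_question_one]
  split_ifs with h
  · exact (((mem_unitObservables_iff x.1).1 x.2).2 t h).ge
  · exact zero_le' _

end Resolution

/-! ### Infima and suprema in the spectral order -/

section Lattice

variable {E : Type u} [CompleteLatticeEffectAlgebra E] {P : Set (Observable E)} {S : Set P}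

theorem isGLB_of_resolution {z : P} (hz : ∀ t, z.1.resolution t = ⨆ x ∈ S, x.1.resolution t) :
    IsGLB S z := by
  refine ⟨fun x hx t => ?_, fun y hy t => ?_⟩
  · rw [hz]
    exact le_iSup₂_of_le x hx le_rfl
  · rw [hz]
    exact iSup₂_le fun x hx => hy hx t

/-- A pointwise infimum may fail to be left-continuous; regularizing loses nothing because every
upper bound has a left-continuous resolution. -/
theorem isLUB_of_resolution {z : P}
    (hz : ∀ t, z.1.resolution t = ⨆ u : ℝ, ⨆ _ : u < t, ⨅ x ∈ S, x.1.resolution u) :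
    IsLUB S z := by
  refine ⟨fun x hx t => ?_, fun y hy t => ?_⟩
  · rw [hz]
    exact iSup₂_le fun u hu => (iInf₂_le x hx).trans (x.1.resolution_mono hu.le)
  · rw [hz]
    refine (y.1.isLUB_resolution t).2 ?_
    rintro _ ⟨u, hu, rfl⟩
    exact le_iSup₂_of_le u hu (le_iInf₂ fun x hx => hy hx u)

/-- A supremum vanishes only where all members do, but equals 1 as soon as one does; hence the
asymmetric hypotheses, which are reversed for suprema of observables. -/
theorem exists_resolution_eq_iSup {a b : ℝ} (ha : ∀ x ∈ S, x.1.resolution a = 0)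
    (hb : ∃ x ∈ S, ∀ t, b < t → x.1.resolution t = 1) :
    ∃ z : Observable E, (z.resolution a = 0 ∧ ∀ t, b < t → z.resolution t = 1) ∧
      ∀ t, z.resolution t = ⨆ x ∈ S, x.1.resolution t := by
  have hbot : ⨆ x ∈ S, x.1.resolution a = ⊥ :=
    le_bot_iff.1 (iSup₂_le fun x hx => (ha x hx).le.trans zero_eq_bot.le)
  have htop : ∀ t, b < t → ⨆ x ∈ S, x.1.resolution t = ⊤ := fun t ht => by
    obtain ⟨x, hx, h⟩ := hb
    refine top_le_iff.1 (le_iSup₂_of_le x hx ?_)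
    rw [h t ht, one_eq_top]
  have hmono : Monotone fun t => ⨆ x ∈ S, x.1.resolution t := fun s t h =>
    iSup₂_mono fun x _ => x.1.resolution_mono h
  obtain ⟨z, hz⟩ := exists_observable hmono (fun t => ⟨by
      rintro _ ⟨s, hs, rfl⟩
      exact hmono (le_of_lt hs), fun w hw => iSup₂_le fun x hx => (x.1.isLUB_resolution t).2 (by
      rintro _ ⟨s, hs, rfl⟩
      exact le_trans (le_iSup₂_of_le x hx le_rfl) (hw ⟨s, hs, rfl⟩))⟩) hbot htop
  refine ⟨z, ⟨?_, fun t ht => ?_⟩, hz⟩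
  · rw [hz, hbot, zero_eq_bot]
  · rw [hz, htop t ht, one_eq_top]

theorem exists_resolution_eq_iSup_iInf {a b : ℝ} (ha : ∃ x ∈ S, x.1.resolution a = 0)
    (hb : ∀ x ∈ S, ∀ t, b < t → x.1.resolution t = 1) :
    ∃ z : Observable E, (z.resolution a = 0 ∧ ∀ t, b < t → z.resolution t = 1) ∧
      ∀ t, z.resolution t = ⨆ u : ℝ, ⨆ _ : u < t, ⨅ x ∈ S, x.1.resolution u := by
  set F : ℝ → E := fun t => ⨆ u : ℝ, ⨆ _ : u < t, ⨅ x ∈ S, x.1.resolution u with hF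
  have hbot : F a = ⊥ := by
    obtain ⟨x, hx, h⟩ := ha
    refine le_bot_iff.1 (iSup₂_le fun u hu => (iInf₂_le x hx).trans ?_)
    rw [← zero_eq_bot, ← h]
    exact x.1.resolution_mono hu.le
  have htop : ∀ t, b < t → F t = ⊤ := fun t ht => by
    obtain ⟨u, hbu, hut⟩ := exists_between ht
    refine top_le_iff.1 (le_iSup₂_of_le u hut (le_iInf₂ fun x hx => ?_))
    rw [hb x hx u hbu, one_eq_top]
  have hmono : Monotone F := fun s t h =>
    iSup₂_le fun u hu => le_iSup₂_of_le u (hu.trans_le h) le_rfl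
  obtain ⟨z, hz⟩ := exists_observable hmono (fun t => ⟨by
      rintro _ ⟨s, hs, rfl⟩
      exact hmono (le_of_lt hs), fun w hw => iSup₂_le fun u hu => by
      -- An intermediate point gives left-continuity of the regularization.
      obtain ⟨s, hus, hst⟩ := exists_between hu
      exact le_trans (le_iSup₂_of_le u hus le_rfl) (hw ⟨s, hst, rfl⟩)⟩) hbot htop
  refine ⟨z, ⟨?_, fun t ht => ?_⟩, hz⟩
  · rw [hz, hbot, zero_eq_bot]
  · rw [hz, htop t ht, one_eq_top]

theorem antisymm (x y : P) (hxy : x ≤ y) (hyx : y ≤ x) : x = y :=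
  Subtype.ext (ext_resolution fun t => le_antisymm (hyx t) (hxy t))

end Lattice

section Bounded

variable {E : Type u} [CompleteLatticeEffectAlgebra E] {S : Set (boundedObservables E)}

theorem exists_isGLB_bounded (hne : S.Nonempty) {a : ℝ} (ha : ∀ x ∈ S, x.1.resolution a = 0) :
    ∃ z : boundedObservables E, IsGLB S z ∧
      ∀ t : ℝ, z.1.resolution t = ⨆ x ∈ S, x.1.resolution t := by
  obtain ⟨x, hx⟩ := hne
  obtain ⟨-, b, -, hb⟩ := (mem_boundedObservables_iff x.1).1 x.2
  obtain ⟨z, hz, hz'⟩ := exists_resolution_eq_iSup ha ⟨x, hx, hb⟩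
  let w : boundedObservables E := ⟨z, (mem_boundedObservables_iff z).2 ⟨a, b, hz⟩⟩
  exact ⟨w, isGLB_of_resolution (z := w) hz', hz'⟩

theorem exists_isLUB_bounded (hne : S.Nonempty) {b : ℝ}
    (hb : ∀ x ∈ S, ∀ t, b < t → x.1.resolution t = 1) :
    ∃ z : boundedObservables E, IsLUB S z ∧
      ∀ t : ℝ, z.1.resolution t = ⨆ u : ℝ, ⨆ _ : u < t, ⨅ x ∈ S, x.1.resolution u := by
  obtain ⟨x, hx⟩ := hne
  obtain ⟨a, -, ha, -⟩ := (mem_boundedObservables_iff x.1).1 x.2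
  obtain ⟨z, hz, hz'⟩ := exists_resolution_eq_iSup_iInf ⟨x, hx, ha⟩ hb
  let w : boundedObservables E := ⟨z, (mem_boundedObservables_iff z).2 ⟨a, b, hz⟩⟩
  exact ⟨w, isLUB_of_resolution (z := w) hz', hz'⟩

theorem isLatticeOrder_boundedObservables : IsLatticeOrder (boundedObservables E) := by
  refine ⟨antisymm, fun x y => ?_⟩
  obtain ⟨a, b, ha, hb⟩ := (mem_boundedObservables_iff x.1).1 x.2
  obtain ⟨a', b', ha', hb'⟩ := (mem_boundedObservables_iff y.1).1 y.2
  obtain ⟨z, hz, -⟩ := exists_isGLB_bounded (S := {x, y}) ⟨x, Or.inl rfl⟩ (a := min a a') (by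
    rintro _ (rfl | rfl)
    · exact le_antisymm (ha ▸ resolution_mono _ (min_le_left _ _)) (zero_le' _)
    · exact le_antisymm (ha' ▸ resolution_mono _ (min_le_right _ _)) (zero_le' _))
  obtain ⟨w, hw, -⟩ := exists_isLUB_bounded (S := {x, y}) ⟨x, Or.inl rfl⟩ (b := max b b') (by
    rintro _ (rfl | rfl) t ht
    · exact hb t ((le_max_left _ _).trans_lt ht)
    · exact hb' t ((le_max_right _ _).trans_lt ht))
  exact ⟨⟨z, hz⟩, w, hw⟩

theorem exists_isGLB_of_bddBelow (hne : S.Nonempty) (h : BddBelow S) :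
    ∃ z : boundedObservables E, IsGLB S z ∧
      ∀ t : ℝ, z.1.resolution t = ⨆ x ∈ S, x.1.resolution t := by
  obtain ⟨l, hl⟩ := h
  obtain ⟨a, -, ha, -⟩ := (mem_boundedObservables_iff l.1).1 l.2
  exact exists_isGLB_bounded hne fun x hx => le_antisymm (ha ▸ hl hx a) (zero_le' _)

theorem exists_isLUB_of_bddAbove (hne : S.Nonempty) (h : BddAbove S) :
    ∃ z : boundedObservables E, IsLUB S z ∧
      ∀ t : ℝ, z.1.resolution t = ⨆ u : ℝ, ⨆ _ : u < t, ⨅ x ∈ S, x.1.resolution u := by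
  obtain ⟨m, hm⟩ := h
  obtain ⟨-, b, -, hb⟩ := (mem_boundedObservables_iff m.1).1 m.2
  exact exists_isLUB_bounded hne fun x hx t ht =>
    le_antisymm (le_one' _) ((hb t ht).ge.trans (hm hx t))

end Bounded

section Unit

variable {E : Type u} [CompleteLatticeEffectAlgebra E]

theorem exists_isGLB_unit (S : Set (unitObservables E)) : ∃ z, IsGLB S z := by
  rcases S.eq_empty_or_nonempty with rfl | ⟨x, hx⟩
  · exact ⟨_, isGLB_empty_iff.2 isTop_question_one⟩
  obtain ⟨z, hz, hz'⟩ := exists_resolution_eq_iSup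
    (fun y (_ : y ∈ S) => ((mem_unitObservables_iff y.1).1 y.2).1)
    ⟨x, hx, ((mem_unitObservables_iff x.1).1 x.2).2⟩
  exact ⟨⟨z, (mem_unitObservables_iff z).2 hz⟩, isGLB_of_resolution hz'⟩

theorem exists_isLUB_unit (S : Set (unitObservables E)) : ∃ z, IsLUB S z := by
  rcases S.eq_empty_or_nonempty with rfl | ⟨x, hx⟩
  · exact ⟨_, isLUB_empty_iff.2 isBot_question_zero⟩
  obtain ⟨z, hz, hz'⟩ := exists_resolution_eq_iSup_iInf
    ⟨x, hx, ((mem_unitObservables_iff x.1).1 x.2).1⟩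
    (fun y (_ : y ∈ S) => ((mem_unitObservables_iff y.1).1 y.2).2)
  exact ⟨⟨z, (mem_unitObservables_iff z).2 hz⟩, isLUB_of_resolution hz'⟩

theorem isCompleteLatticeOrder_unitObservables : IsCompleteLatticeOrder (unitObservables E) :=
  ⟨⟨antisymm, fun x y => ⟨exists_isGLB_unit {x, y}, exists_isLUB_unit {x, y}⟩⟩,
    fun S => ⟨exists_isGLB_unit S, exists_isLUB_unit S⟩⟩

end Unit

end Observable

theorem theorem3p6 {E : Type u} [CompleteLatticeEffectAlgebra E] :
    IsDedekindCompleteLattice (boundedObservables E) ∧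
    (∀ S : Set (boundedObservables E), S.Nonempty → BddBelow S →
      ∃ z : boundedObservables E, IsGLB S z ∧
        ∀ t : ℝ, z.1.resolution t = ⨆ x ∈ S, x.1.resolution t) ∧
    (∀ S : Set (boundedObservables E), S.Nonempty → BddAbove S →
      ∃ z : boundedObservables E, IsLUB S z ∧
        ∀ t : ℝ, z.1.resolution t = ⨆ u : ℝ, ⨆ _ : u < t, ⨅ x ∈ S, x.1.resolution u) ∧
    IsCompleteLatticeOrder (unitObservables E) ∧
    ∃ (h0 : Observable.question (0 : E) ∈ unitObservables E)
      (h1 : Observable.question (1 : E) ∈ unitObservables E),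
      IsBot (⟨Observable.question 0, h0⟩ : unitObservables E) ∧
      IsTop (⟨Observable.question 1, h1⟩ : unitObservables E) := by
  refine ⟨⟨Observable.isLatticeOrder_boundedObservables, fun S hne hb => ?_, fun S hne hb => ?_⟩,
    fun S => Observable.exists_isGLB_of_bddBelow, fun S => Observable.exists_isLUB_of_bddAbove,
    Observable.isCompleteLatticeOrder_unitObservables, Observable.question_zero_mem,
    Observable.question_one_mem, Observable.isBot_question_zero, Observable.isTop_question_one⟩
  · obtain ⟨z, hz, -⟩ := Observable.exists_isGLB_of_bddBelow hne hb
    exact ⟨z, hz⟩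
  · obtain ⟨z, hz, -⟩ := Observable.exists_isLUB_of_bddAbove hne hb
    exact ⟨z, hz⟩
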